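/- Let $\mathfrak s$ be the Schrödinger Lie algebra over $\mathbb C$, i.e. the complex Lie algebra with basis $e,h,f,p,q,z$ and brackets $[h,e]=2e$, $[h,f]=-2f$, $[e,f]=h$, $[e,p]=0$, $[h,p]=p$, $[f,p]=q$, $[e,q]=p$, $[h,q]=-q$, $[f,q]=0$, $[p,q]=z$, and $z$ central. Let $\mathfrak g=\operatorname{span}(e,h,f)\cong\mathfrak{sl}_2$ be its Levi subalgebra. An $\mathfrak s$-module is called a $\mathfrak g$-Harish-Chandra module if its restriction to $\mathfrak g$ is a direct sum of simple finite-dimensional $\mathfrak g$-modules in which each isomorphism class of simple finite-dimensional $\mathfrak g$-modules occurs with finite multiplicity. Let $V$ be a simple infinite-dimensional $\mathfrak g$-Harish-Chandra module for $\mathfrak s$. Then $$\operatorname{Ext}^1(V,V)\cong\mathbb C$$ as complex vector spaces, where $\operatorname{Ext}^1$ is taken in the category of all $\mathfrak s$-modules, i.e. of modules over the universal enveloping algebra $U(\mathfrak s)$. -/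

import Mathlib

/-- The underlying space of the Schrödinger Lie algebra: the coordinates `0, 1, 2, 3, 4, 5` are the
coefficients of the basis vectors `e, h, f, p, q, z`, in this order. -/
def SchrodingerAlgebra : Type := Fin 6 → ℂ

namespace SchrodingerAlgebra

noncomputable instance : AddCommGroup SchrodingerAlgebra := inferInstanceAs (AddCommGroup (Fin 6 → ℂ))

noncomputable instance : Module ℂ SchrodingerAlgebra := inferInstanceAs (Module ℂ (Fin 6 → ℂ))

@[ext] theorem ext {x y : SchrodingerAlgebra} (h : ∀ i : Fin 6, x i = y i) : x = y := funext h

@[simp] theorem add_apply (x y : SchrodingerAlgebra) (i : Fin 6) : (x + y) i = x i + y i := rfl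

@[simp] theorem neg_apply (x : SchrodingerAlgebra) (i : Fin 6) : (-x) i = -x i := rfl

@[simp] theorem zero_apply (i : Fin 6) : (0 : SchrodingerAlgebra) i = 0 := rfl

@[simp] theorem smul_apply (c : ℂ) (x : SchrodingerAlgebra) (i : Fin 6) : (c • x) i = c * x i := rfl

/-- The bracket, the bilinear alternating extension of
`[h,e] = 2e`, `[h,f] = -2f`, `[e,f] = h`, `[h,p] = p`, `[h,q] = -q`, `[e,q] = p`, `[f,p] = q`,
`[p,q] = z`, the other brackets of basis vectors being zero
(see the lemmas on brackets of basis vectors below). -/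
noncomputable instance : Bracket SchrodingerAlgebra SchrodingerAlgebra where
  bracket x y :=
    ![2 * (x 1 * y 0 - x 0 * y 1),
      x 0 * y 2 - x 2 * y 0,
      -2 * (x 1 * y 2 - x 2 * y 1),
      (x 1 * y 3 - x 3 * y 1) + (x 0 * y 4 - x 4 * y 0),
      (x 2 * y 3 - x 3 * y 2) - (x 1 * y 4 - x 4 * y 1),
      x 3 * y 4 - x 4 * y 3]

@[simp] theorem lie_apply_0 (x y : SchrodingerAlgebra) :
    ⁅x, y⁆ 0 = 2 * (x 1 * y 0 - x 0 * y 1) := rfl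

@[simp] theorem lie_apply_1 (x y : SchrodingerAlgebra) :
    ⁅x, y⁆ 1 = x 0 * y 2 - x 2 * y 0 := rfl

@[simp] theorem lie_apply_2 (x y : SchrodingerAlgebra) :
    ⁅x, y⁆ 2 = -2 * (x 1 * y 2 - x 2 * y 1) := rfl

@[simp] theorem lie_apply_3 (x y : SchrodingerAlgebra) :
    ⁅x, y⁆ 3 = (x 1 * y 3 - x 3 * y 1) + (x 0 * y 4 - x 4 * y 0) := rfl

@[simp] theorem lie_apply_4 (x y : SchrodingerAlgebra) :
    ⁅x, y⁆ 4 = (x 2 * y 3 - x 3 * y 2) - (x 1 * y 4 - x 4 * y 1) := rfl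

@[simp] theorem lie_apply_5 (x y : SchrodingerAlgebra) :
    ⁅x, y⁆ 5 = x 3 * y 4 - x 4 * y 3 := rfl

noncomputable instance : LieRing SchrodingerAlgebra where
  add_lie x y w := by ext i; fin_cases i <;> simp <;> ring
  lie_add x y w := by ext i; fin_cases i <;> simp <;> ring
  lie_self x := by ext i; fin_cases i <;> simp <;> ring
  leibniz_lie x y w := by ext i; fin_cases i <;> simp <;> ring

noncomputable instance : LieAlgebra ℂ SchrodingerAlgebra where
  lie_smul c x y := by ext i; fin_cases i <;> simp <;> ring

/-- The basis `e, h, f, p, q, z` of the Schrödinger Lie algebra. -/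
noncomputable def basis : Module.Basis (Fin 6) ℂ SchrodingerAlgebra := Pi.basisFun ℂ (Fin 6)

noncomputable def e : SchrodingerAlgebra := basis 0
noncomputable def h : SchrodingerAlgebra := basis 1
noncomputable def f : SchrodingerAlgebra := basis 2
noncomputable def p : SchrodingerAlgebra := basis 3
noncomputable def q : SchrodingerAlgebra := basis 4
noncomputable def z : SchrodingerAlgebra := basis 5

theorem basis_apply (i j : Fin 6) : basis i j = if j = i then 1 else 0 := by
  have : basis i j = (Pi.single i (1 : ℂ) : Fin 6 → ℂ) j :=
    congrFun (Pi.basisFun_apply ℂ (Fin 6) i) j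
  rw [this, Pi.single_apply]

theorem lie_h_e : ⁅h, e⁆ = (2 : ℂ) • e := by
  ext i; fin_cases i <;> simp [h, e, basis_apply]
theorem lie_h_f : ⁅h, f⁆ = (-2 : ℂ) • f := by
  ext i; fin_cases i <;> simp [h, f, basis_apply]
theorem lie_e_f : ⁅e, f⁆ = h := by
  ext i; fin_cases i <;> simp [e, h, f, basis_apply]
theorem lie_e_p : ⁅e, p⁆ = 0 := by
  ext i; fin_cases i <;> simp [e, p, basis_apply]
theorem lie_h_p : ⁅h, p⁆ = p := by
  ext i; fin_cases i <;> simp [h, p, basis_apply]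
theorem lie_f_p : ⁅f, p⁆ = q := by
  ext i; fin_cases i <;> simp [f, p, q, basis_apply]
theorem lie_e_q : ⁅e, q⁆ = p := by
  ext i; fin_cases i <;> simp [e, p, q, basis_apply]
theorem lie_h_q : ⁅h, q⁆ = -q := by
  ext i; fin_cases i <;> simp [h, q, basis_apply]
theorem lie_f_q : ⁅f, q⁆ = 0 := by
  ext i; fin_cases i <;> simp [f, q, basis_apply]
theorem lie_p_q : ⁅p, q⁆ = z := by
  ext i; fin_cases i <;> simp [p, q, z, basis_apply]
theorem lie_z (x : SchrodingerAlgebra) : ⁅x, z⁆ = 0 := by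
  ext i; fin_cases i <;> simp [z, basis_apply]

/-- The Levi subalgebra `sl₂` of the Schrödinger Lie algebra: the span of `e, h, f`, i.e. the
vectors whose coefficients at `p, q, z` vanish. -/
noncomputable def sl2 : LieSubalgebra ℂ SchrodingerAlgebra where
  carrier := {x | x 3 = 0 ∧ x 4 = 0 ∧ x 5 = 0}
  add_mem' := by
    rintro x y ⟨h3, h4, h5⟩ ⟨k3, k4, k5⟩
    simp [h3, h4, h5, k3, k4, k5]
  zero_mem' := by simp
  smul_mem' := by
    rintro c x ⟨h3, h4, h5⟩
    simp [h3, h4, h5]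
  lie_mem' := by
    rintro x y ⟨h3, h4, h5⟩ ⟨k3, k4, k5⟩
    simp [h3, h4, k3, k4]

theorem sl2_toSubmodule_eq_span : sl2.toSubmodule = Submodule.span ℂ {e, h, f} := by
  apply le_antisymm
  · rintro x ⟨h3, h4, h5⟩
    have hx : x = x 0 • e + x 1 • h + x 2 • f := by
      ext i
      fin_cases i <;> simp [e, h, f, basis_apply, h3, h4, h5]
    rw [hx]
    refine add_mem (add_mem ?_ ?_) ?_ <;>
      exact Submodule.smul_mem _ _ (Submodule.subset_span (by simp))
  · rw [Submodule.span_le]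
    rintro x (rfl | rfl | rfl)
    · exact ⟨by simp [e, basis_apply], by simp [e, basis_apply], by simp [e, basis_apply]⟩
    · exact ⟨by simp [h, basis_apply], by simp [h, basis_apply], by simp [h, basis_apply]⟩
    · exact ⟨by simp [f, basis_apply], by simp [f, basis_apply], by simp [f, basis_apply]⟩

end SchrodingerAlgebra

section Modules

universe u v

open Classical in
/-- For a Lie subalgebra `g` of a complex Lie algebra `L`, an `L`-module `V` is a `g`-Harish-Chandra
module if its restriction to `g` is an (internal) direct sum of simple finite-dimensional
`g`-submodules `W i` in which each isomorphism class occurs only finitely many times. -/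
def IsHarishChandraModule {L : Type u} [LieRing L] [LieAlgebra ℂ L] (g : LieSubalgebra ℂ L)
    (V : Type v) [AddCommGroup V] [Module ℂ V] [LieRingModule L V] [LieModule ℂ L V] : Prop :=
  ∃ (ι : Type v) (W : ι → LieSubmodule ℂ g V),
    DirectSum.IsInternal (fun i => (W i).toSubmodule) ∧
    (∀ i, LieModule.IsIrreducible ℂ g (W i) ∧ FiniteDimensional ℂ (W i)) ∧
    ∀ i, {j | Nonempty (W j ≃ₗ⁅ℂ, g⁆ W i)}.Finite

/-- The `U(L)`-module attached to an `L`-module `V`, as an object of the category of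
`U(L)`-modules. -/
noncomputable def envelopingModule (L : Type u) [LieRing L] [LieAlgebra ℂ L]
    (V : Type v) [AddCommGroup V] [Module ℂ V] [LieRingModule L V] [LieModule ℂ L V] :
    ModuleCat.{v} (UniversalEnvelopingAlgebra ℂ L) :=
  letI : Module (UniversalEnvelopingAlgebra ℂ L) V :=
    Module.compHom V (UniversalEnvelopingAlgebra.lift ℂ (LieModule.toEnd ℂ L V)).toRingHom
  ModuleCat.of (UniversalEnvelopingAlgebra ℂ L) V

theorem envelopingModule_ι_smul {L : Type u} [LieRing L] [LieAlgebra ℂ L]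
    {V : Type v} [AddCommGroup V] [Module ℂ V] [LieRingModule L V] [LieModule ℂ L V]
    (x : L) (v : V) :
    (UniversalEnvelopingAlgebra.ι ℂ x • (show envelopingModule L V from v) :
      envelopingModule L V) = (show envelopingModule L V from (⁅x, v⁆ : V)) := by
  change (UniversalEnvelopingAlgebra.lift ℂ (LieModule.toEnd ℂ L V)
    (UniversalEnvelopingAlgebra.ι ℂ x)) v = ⁅x, v⁆
  rw [UniversalEnvelopingAlgebra.lift_ι_apply]
  rfl

theorem envelopingModule_algebraMap_smul {L : Type u} [LieRing L] [LieAlgebra ℂ L]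
    {V : Type v} [AddCommGroup V] [Module ℂ V] [LieRingModule L V] [LieModule ℂ L V]
    (c : ℂ) (v : V) :
    (algebraMap ℂ (UniversalEnvelopingAlgebra ℂ L) c • (show envelopingModule L V from v) :
      envelopingModule L V) = (show envelopingModule L V from c • v) := by
  change (UniversalEnvelopingAlgebra.lift ℂ (LieModule.toEnd ℂ L V)
    (algebraMap ℂ _ c)) v = c • v
  rw [AlgHom.commutes]
  rfl

end Modules

/-! Let `n` be the lowest `sl₂`-type of `V`, with highest weight vector `v`. For a highest weight
vector `u` of weight `n`, `(n + 1) q u - f p u` is a highest weight vector of weight `n - 1`, hence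
zero. So `q` can be eliminated, and the vectors `f ^ i p ^ k v` span an invariant subspace once `z`
acts on `v` by a scalar. These vectors have distinct eigenvalues of the twisted Casimir operator, so
such a subspace contains no highest weight vectors of weight `n` beyond the evident ones
(`raisedSpan_stable`, `mem_of_mem_raisedSpan_zero`). By simplicity, type `n` has multiplicity one
and `z` acts by a scalar `c`. If `c` were zero, the vectors with `k ≥ 1` would span a proper
invariant subspace, and `V` would be finite-dimensional.

A self-extension is given by a cocycle `φ`, and by Schur's lemma `φ z` is a scalar. This scalar is
the only invariant. If it vanishes, `z` still acts by `c` on the extension. There `v` lifts to a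
highest weight vector (`IsCocycle.exists_lift_highestWeight`), and the invariant subspace it
generates is a complement (`IsCocycle.exists_eq_commutator`). Conversely, coboundaries vanish at
`z`, while composing the action with the derivation that halves `p`, `q` and fixes `z` gives a
cocycle with value `c ≠ 0` at `z`. Cocycles are compared with `Ext` through a free presentation of
`V`. -/

namespace SchrodingerAlgebra

open Module

attribute [local instance] LieRing.ofAssociativeRing

/-! ### Commutation relations and highest weight vectors -/

section Representation

variable {E : Type*} [AddCommGroup E] [Module ℂ E] (ρ : SchrodingerAlgebra →ₗ⁅ℂ⁆ End ℂ E)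

theorem apply_apply (x y : SchrodingerAlgebra) (w : E) :
    ρ x (ρ y w) = ρ y (ρ x w) + ρ ⁅x, y⁆ w := by
  rw [LieHom.map_lie, Ring.lie_def]
  simp

theorem h_e_apply (w : E) : ρ h (ρ e w) = ρ e (ρ h w) + (2 : ℂ) • ρ e w := by
  rw [apply_apply, lie_h_e, map_smul, LinearMap.smul_apply]

theorem h_f_apply (w : E) : ρ h (ρ f w) = ρ f (ρ h w) + (-2 : ℂ) • ρ f w := by
  rw [apply_apply, lie_h_f, map_smul, LinearMap.smul_apply]

theorem e_f_apply (w : E) : ρ e (ρ f w) = ρ f (ρ e w) + ρ h w := by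
  rw [apply_apply, lie_e_f]

theorem e_p_apply (w : E) : ρ e (ρ p w) = ρ p (ρ e w) := by
  rw [apply_apply, lie_e_p, map_zero, LinearMap.zero_apply, add_zero]

theorem h_p_apply (w : E) : ρ h (ρ p w) = ρ p (ρ h w) + ρ p w := by
  rw [apply_apply, lie_h_p]

theorem p_f_apply (w : E) : ρ p (ρ f w) = ρ f (ρ p w) - ρ q w := by
  rw [apply_apply ρ f p, lie_f_p, add_sub_cancel_right]

theorem e_q_apply (w : E) : ρ e (ρ q w) = ρ q (ρ e w) + ρ p w := by
  rw [apply_apply, lie_e_q]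

theorem h_q_apply (w : E) : ρ h (ρ q w) = ρ q (ρ h w) - ρ q w := by
  rw [apply_apply, lie_h_q, map_neg, LinearMap.neg_apply, sub_eq_add_neg]

theorem q_f_apply (w : E) : ρ q (ρ f w) = ρ f (ρ q w) := by
  rw [apply_apply ρ f q, lie_f_q, map_zero, LinearMap.zero_apply, add_zero]

theorem q_p_apply (w : E) : ρ q (ρ p w) = ρ p (ρ q w) - ρ z w := by
  rw [apply_apply ρ p q, lie_p_q, add_sub_cancel_right]

theorem z_apply (x : SchrodingerAlgebra) (w : E) : ρ z (ρ x w) = ρ x (ρ z w) := by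
  rw [apply_apply ρ x z, lie_z, map_zero, LinearMap.zero_apply, add_zero]

theorem eq_sum_basis (x : SchrodingerAlgebra) :
    x = x 0 • e + x 1 • h + x 2 • f + x 3 • p + x 4 • q + x 5 • z := by
  ext i
  fin_cases i <;> simp [e, h, f, p, q, z, basis_apply]

/-- The vectors of weight `μ` killed by `e`. -/
noncomputable def highestWeightSpace (μ : ℂ) : Submodule ℂ E :=
  LinearMap.ker (ρ e) ⊓ LinearMap.ker (ρ h - μ • 1)

variable {ρ}

theorem mem_highestWeightSpace {μ : ℂ} {w : E} :
    w ∈ highestWeightSpace ρ μ ↔ ρ e w = 0 ∧ ρ h w = μ • w := by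
  simp [highestWeightSpace, sub_eq_zero]

theorem h_f_pow_of_h {μ : ℂ} {w : E} (hw : ρ h w = μ • w) (i : ℕ) :
    ρ h ((ρ f ^ i) w) = (μ - 2 * i) • (ρ f ^ i) w := by
  induction i with
  | zero => simpa using hw
  | succ i ih =>
    rw [pow_succ', End.mul_apply, h_f_apply, ih, map_smul, ← add_smul]
    congr 1
    push_cast
    ring

/-- Asking only `ρ f (ρ e w) = 0` matters when highest weight vectors are lifted: there the formula
serves a vector not yet known to be killed by `e`. -/
theorem e_f_pow_succ_of_f_e {μ : ℂ} {w : E} (hh : ρ h w = μ • w) (hfe : ρ f (ρ e w) = 0)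
    (i : ℕ) : ρ e ((ρ f ^ (i + 1)) w) = ((i + 1) * (μ - i)) • (ρ f ^ i) w := by
  induction i with
  | zero => simp [e_f_apply, hfe, hh]
  | succ i ih =>
    rw [pow_succ', End.mul_apply, e_f_apply, ih, h_f_pow_of_h hh, map_smul, ← End.mul_apply,
      ← pow_succ', ← add_smul]
    congr 1
    push_cast
    ring

theorem e_f_pow_succ {μ : ℂ} {w : E} (hw : w ∈ highestWeightSpace ρ μ) (i : ℕ) :
    ρ e ((ρ f ^ (i + 1)) w) = ((i + 1) * (μ - i)) • (ρ f ^ i) w :=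
  e_f_pow_succ_of_f_e (mem_highestWeightSpace.1 hw).2
    (by rw [(mem_highestWeightSpace.1 hw).1, map_zero]) i

theorem f_e_f_pow {μ : ℂ} {w : E} (hw : w ∈ highestWeightSpace ρ μ) (i : ℕ) :
    ρ f (ρ e ((ρ f ^ i) w)) = (i * (μ - i + 1)) • (ρ f ^ i) w := by
  cases i with
  | zero => simp [(mem_highestWeightSpace.1 hw).1]
  | succ i =>
    rw [e_f_pow_succ hw, map_smul, ← End.mul_apply, ← pow_succ']
    congr 1
    push_cast
    ring

theorem p_pow_mem_highestWeightSpace {μ : ℂ} {w : E} (hw : w ∈ highestWeightSpace ρ μ) (k : ℕ) :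
    (ρ p ^ k) w ∈ highestWeightSpace ρ (μ + k) := by
  induction k with
  | zero => simpa using hw
  | succ k ih =>
    obtain ⟨he, hh⟩ := mem_highestWeightSpace.1 ih
    rw [pow_succ', End.mul_apply, mem_highestWeightSpace, e_p_apply, he, h_p_apply, hh, map_smul]
    refine ⟨map_zero _, ?_⟩
    push_cast
    module

/-- The factors `(i + 1) * (μ - i)` never vanish, so applying `e` descends from `f ^ (N + 1) w = 0`
to `f ^ N w = 0`. -/
theorem eq_zero_of_f_e_of_f_pow {μ : ℂ} {w : E} (hh : ρ h w = μ • w)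
    (hfe : ρ f (ρ e w) = 0) (hμ : ∀ m : ℕ, μ ≠ m) {N : ℕ} (hN : (ρ f ^ N) w = 0) : w = 0 := by
  induction N with
  | zero => simpa using hN
  | succ N ih =>
    refine ih ?_
    have := e_f_pow_succ_of_f_e hh hfe N
    rw [hN, map_zero, eq_comm, smul_eq_zero] at this
    refine this.resolve_left (mul_ne_zero (by exact_mod_cast N.succ_ne_zero) ?_)
    exact sub_ne_zero.2 (hμ N)

theorem eq_zero_of_f_pow_eq_zero {μ : ℂ} {w : E} (hw : w ∈ highestWeightSpace ρ μ)
    (hμ : ∀ m : ℕ, μ ≠ m) {N : ℕ} (hN : (ρ f ^ N) w = 0) : w = 0 :=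
  eq_zero_of_f_e_of_f_pow (mem_highestWeightSpace.1 hw).2
    (by rw [(mem_highestWeightSpace.1 hw).1, map_zero]) hμ hN

theorem eq_zero_of_f_pow_nat_eq_zero {n : ℕ} {w : E} (hw : w ∈ highestWeightSpace ρ n)
    {N : ℕ} (hNn : N ≤ n) (hN : (ρ f ^ N) w = 0) : w = 0 := by
  induction N with
  | zero => simpa using hN
  | succ N ih =>
    refine ih (by omega) ?_
    have := e_f_pow_succ hw N
    rw [hN, map_zero, eq_comm, smul_eq_zero] at this
    refine this.resolve_left (mul_ne_zero (by exact_mod_cast N.succ_ne_zero) ?_)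
    refine sub_ne_zero.2 fun hc => ?_
    have : n = N := by exact_mod_cast hc
    omega

/-- The vector `f ^ (n + 1) w` is again killed by `e`, and its weight `-(n + 2)` is negative, which
is incompatible with nilpotency of `f` unless it is zero. -/
theorem f_pow_succ_eq_zero {n : ℕ} {w : E} (hw : w ∈ highestWeightSpace ρ n)
    {N : ℕ} (hN : (ρ f ^ N) w = 0) : (ρ f ^ (n + 1)) w = 0 := by
  have hmem : (ρ f ^ (n + 1)) w ∈ highestWeightSpace ρ (-(n + 2)) := by
    rw [mem_highestWeightSpace, e_f_pow_succ hw, h_f_pow_of_h (mem_highestWeightSpace.1 hw).2]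
    refine ⟨by simp, ?_⟩
    congr 1
    push_cast
    ring
  refine eq_zero_of_f_pow_eq_zero hmem (N := N) (fun m hm => ?_) ?_
  · have : (m : ℂ) + n + 2 = 0 := by rw [← hm]; ring
    exact absurd this (by exact_mod_cast (m + n + 1).succ_ne_zero)
  · rw [← End.mul_apply, ← pow_add, add_comm, pow_add, End.mul_apply, hN, map_zero]

/-! ### Invariant subspaces generated by the lowest type -/

variable (ρ) in
/-- The operator `C + i h`, where `C = h² + 2h + 4fe` is the Casimir operator of `sl₂`. Its
eigenvalues separate the pairs (Casimir eigenvalue, weight) for integral weights. -/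
noncomputable def twistedCasimir : End ℂ E :=
  ρ h * ρ h + (2 : ℂ) • ρ h + (4 : ℂ) • (ρ f * ρ e) + Complex.I • ρ h

theorem f_pow_mem_eigenspace {μ : ℂ} {w : E} (hw : w ∈ highestWeightSpace ρ μ) (i : ℕ) :
    (ρ f ^ i) w ∈ (twistedCasimir ρ).eigenspace (μ * (μ + 2) + Complex.I * (μ - 2 * i)) := by
  rw [End.mem_eigenspace_iff]
  simp only [twistedCasimir, LinearMap.add_apply, End.mul_apply, LinearMap.smul_apply,
    h_f_pow_of_h (mem_highestWeightSpace.1 hw).2, f_e_f_pow hw, map_smul]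
  module

/-- The span of the vectors `f ^ i p ^ k u` with `u` in `K` and `k ≥ k₀`. -/
def raisedSpan (ρ : SchrodingerAlgebra →ₗ⁅ℂ⁆ End ℂ E) (K : Submodule ℂ E) (k₀ : ℕ) :
    Submodule ℂ E :=
  Submodule.span ℂ {x | ∃ u ∈ K, ∃ i k, k₀ ≤ k ∧ x = (ρ f ^ i) ((ρ p ^ k) u)}

theorem f_pow_p_pow_mem_raisedSpan {K : Submodule ℂ E} {k₀ k : ℕ} (hk : k₀ ≤ k) {u : E}
    (hu : u ∈ K) (i : ℕ) : (ρ f ^ i) ((ρ p ^ k) u) ∈ raisedSpan ρ K k₀ :=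
  Submodule.subset_span ⟨u, hu, i, k, hk, rfl⟩

theorem p_pow_mem_raisedSpan {K : Submodule ℂ E} {k₀ k : ℕ} (hk : k₀ ≤ k) {u : E}
    (hu : u ∈ K) : (ρ p ^ k) u ∈ raisedSpan ρ K k₀ :=
  f_pow_p_pow_mem_raisedSpan hk hu 0

theorem raisedSpan_le_comap_of_forall {K : Submodule ℂ E} {k₀ : ℕ} {T : End ℂ E}
    (hT : ∀ u ∈ K, ∀ i k, k₀ ≤ k → T ((ρ f ^ i) ((ρ p ^ k) u)) ∈ raisedSpan ρ K k₀) {x : E}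
    (hx : x ∈ raisedSpan ρ K k₀) : T x ∈ raisedSpan ρ K k₀ := by
  have : raisedSpan ρ K k₀ ≤ (raisedSpan ρ K k₀).comap T := by
    rw [raisedSpan, Submodule.span_le]
    rintro _ ⟨u, hu, i, k, hk, rfl⟩
    exact hT u hu i k hk
  exact this hx

theorem f_mem_raisedSpan {K : Submodule ℂ E} {k₀ : ℕ} {x : E} (hx : x ∈ raisedSpan ρ K k₀) :
    ρ f x ∈ raisedSpan ρ K k₀ :=
  raisedSpan_le_comap_of_forall (fun u hu i k hk => by
    rw [← End.mul_apply, ← pow_succ']; exact f_pow_p_pow_mem_raisedSpan hk hu _) hx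

theorem f_pow_mem_raisedSpan {K : Submodule ℂ E} {k₀ : ℕ} {x : E} (hx : x ∈ raisedSpan ρ K k₀)
    (i : ℕ) : (ρ f ^ i) x ∈ raisedSpan ρ K k₀ := by
  induction i with
  | zero => exact hx
  | succ i ih => rw [pow_succ', End.mul_apply]; exact f_mem_raisedSpan ih

theorem q_f_pow (i : ℕ) (x : E) : ρ q ((ρ f ^ i) x) = (ρ f ^ i) (ρ q x) := by
  induction i with
  | zero => rfl
  | succ i ih => rw [pow_succ', End.mul_apply, q_f_apply, ih, End.mul_apply]

theorem z_f_pow (i : ℕ) (x : E) : ρ z ((ρ f ^ i) x) = (ρ f ^ i) (ρ z x) := by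
  induction i with
  | zero => rfl
  | succ i ih => rw [pow_succ', End.mul_apply, z_apply, ih, End.mul_apply]

theorem z_p_pow (i : ℕ) (x : E) : ρ z ((ρ p ^ i) x) = (ρ p ^ i) (ρ z x) := by
  induction i with
  | zero => rfl
  | succ i ih => rw [pow_succ', End.mul_apply, z_apply, ih, End.mul_apply]

theorem p_f_pow (i : ℕ) (x : E) :
    ρ p ((ρ f ^ i) x) = (ρ f ^ i) (ρ p x) - (i : ℂ) • (ρ f ^ (i - 1)) (ρ q x) := by
  induction i with
  | zero => simp
  | succ i ih =>
    rw [pow_succ', End.mul_apply, p_f_apply, ih, q_f_pow, End.mul_apply, map_sub, map_smul]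
    cases i with
    | zero => simp
    | succ i =>
      simp only [Nat.add_sub_cancel, pow_succ', End.mul_apply]
      push_cast
      module

/-- The relation at `k = 0` propagates by commuting `q` past `p` and `p` past `f`. The value of `β`
plays no role; the factor `k` kills the last term at `k = 0`, where the exponent `k - 1` is
truncated. -/
theorem q_p_pow {n : ℕ} {u : E} (hu : ((n : ℂ) + 1) • ρ q u = ρ f (ρ p u)) (k : ℕ) :
    ∃ β : ℂ, ρ q ((ρ p ^ k) u) =
      ((n : ℂ) + k + 1)⁻¹ • ρ f ((ρ p ^ (k + 1)) u) + (k * β) • (ρ p ^ (k - 1)) (ρ z u) := by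
  have hne (k : ℕ) : (n : ℂ) + k + 1 ≠ 0 := by exact_mod_cast (n + k).succ_ne_zero
  induction k with
  | zero =>
    refine ⟨0, ?_⟩
    have h0 := hne 0
    rw [Nat.cast_zero, add_zero] at h0
    simp [← hu, smul_smul, h0]
  | succ k ih =>
    obtain ⟨β, hβ⟩ := ih
    have hk : (k * β) • ρ p ((ρ p ^ (k - 1)) (ρ z u)) = (k * β) • (ρ p ^ k) (ρ z u) := by
      cases k with
      | zero => simp
      | succ k => rw [Nat.add_sub_cancel, ← End.mul_apply, ← pow_succ']
    -- The unknown `q p ^ (k + 1) u` reappears on the right through `p f = f p - q`; its total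
    -- coefficient is `(n + k + 2) / (n + k + 1)`, so the equation can be solved for it.
    have key : ρ q ((ρ p ^ (k + 1)) u) =
        ((n : ℂ) + k + 1)⁻¹ • (ρ f ((ρ p ^ (k + 2)) u) - ρ q ((ρ p ^ (k + 1)) u)) +
          (k * β - 1) • (ρ p ^ k) (ρ z u) := by
      conv_lhs => rw [pow_succ', End.mul_apply, q_p_apply, hβ, map_add, map_smul, map_smul, hk,
        p_f_apply, ← End.mul_apply (ρ p), ← pow_succ', z_p_pow]
      module
    have hd := hne k
    have hd' := hne (k + 1)
    have hk' : (k : ℂ) + 1 ≠ 0 := by exact_mod_cast k.succ_ne_zero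
    refine ⟨((n : ℂ) + (k + 1 : ℕ) + 1)⁻¹ * ((n : ℂ) + k + 1) * (k * β - 1) / (k + 1), ?_⟩
    have hsum : ((n : ℂ) + (k + 1 : ℕ) + 1) • ρ q ((ρ p ^ (k + 1)) u) =
        ρ f ((ρ p ^ (k + 2)) u) + (((n : ℂ) + k + 1) * (k * β - 1)) • (ρ p ^ k) (ρ z u) := by
      have := congrArg (fun x => ((n : ℂ) + k + 1) • x) key
      simp only [smul_add, smul_smul, mul_inv_cancel₀ hd, one_smul] at this
      have h2 : ((n : ℂ) + (k + 1 : ℕ) + 1) • ρ q ((ρ p ^ (k + 1)) u) =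
          ((n : ℂ) + k + 1) • ρ q ((ρ p ^ (k + 1)) u) + ρ q ((ρ p ^ (k + 1)) u) := by
        push_cast
        module
      rw [h2, this]
      abel
    rw [← inv_smul_smul₀ hd' (ρ q ((ρ p ^ (k + 1)) u)), hsum, smul_add, smul_smul,
      Nat.add_sub_cancel]
    congr 2
    push_cast
    field_simp

/-- The term in `z` lowers the exponent of `p`, so for `k₀ > 0` it could leave the span; this is why
`k₀ = 0` or `ρ z = 0` is required. -/
theorem q_p_pow_mem_raisedSpan {n : ℕ} {K : Submodule ℂ E} (hz : ∀ u ∈ K, ρ z u ∈ K)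
    (hq : ∀ u ∈ K, ((n : ℂ) + 1) • ρ q u = ρ f (ρ p u)) {k₀ : ℕ} (h0 : k₀ = 0 ∨ ρ z = 0) {k : ℕ}
    (hk : k₀ ≤ k) {u : E} (hu : u ∈ K) : ρ q ((ρ p ^ k) u) ∈ raisedSpan ρ K k₀ := by
  obtain ⟨β, hβ⟩ := q_p_pow (hq u hu) k
  rw [hβ]
  refine add_mem (Submodule.smul_mem _ _ (f_mem_raisedSpan (p_pow_mem_raisedSpan (by omega) hu)))
    (Submodule.smul_mem _ _ ?_)
  rcases h0 with rfl | h0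
  · exact p_pow_mem_raisedSpan (Nat.zero_le _) (hz u hu)
  · simp [h0]

theorem raisedSpan_stable {n : ℕ} {K : Submodule ℂ E} (hK : K ≤ highestWeightSpace ρ n)
    (hz : ∀ u ∈ K, ρ z u ∈ K) (hq : ∀ u ∈ K, ((n : ℂ) + 1) • ρ q u = ρ f (ρ p u)) {k₀ : ℕ}
    (h0 : k₀ = 0 ∨ ρ z = 0) (x : SchrodingerAlgebra) {w : E} (hw : w ∈ raisedSpan ρ K k₀) :
    ρ x w ∈ raisedSpan ρ K k₀ := by
  have hkey : ∀ u ∈ K, ∀ k : ℕ, (ρ p ^ k) u ∈ highestWeightSpace ρ (n + k) :=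
    fun u hu k => p_pow_mem_highestWeightSpace (hK hu) k
  have hqk {k : ℕ} (hk : k₀ ≤ k) {u : E} (hu : u ∈ K) := q_p_pow_mem_raisedSpan hz hq h0 hk hu
  rw [eq_sum_basis x]
  simp only [map_add, map_smul, LinearMap.add_apply, LinearMap.smul_apply]
  refine add_mem (add_mem (add_mem (add_mem (add_mem ?_ ?_) ?_) ?_) ?_) ?_ <;>
    refine Submodule.smul_mem _ _ ?_
  · refine raisedSpan_le_comap_of_forall (fun u hu i k hk => ?_) hw
    cases i with
    | zero =>
      rw [pow_zero, End.one_apply, (mem_highestWeightSpace.1 (hkey u hu k)).1]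
      exact zero_mem _
    | succ i =>
      rw [e_f_pow_succ (hkey u hu k)]
      exact Submodule.smul_mem _ _ (f_pow_p_pow_mem_raisedSpan hk hu i)
  · refine raisedSpan_le_comap_of_forall (fun u hu i k hk => ?_) hw
    rw [h_f_pow_of_h (mem_highestWeightSpace.1 (hkey u hu k)).2]
    exact Submodule.smul_mem _ _ (f_pow_p_pow_mem_raisedSpan hk hu i)
  · exact f_mem_raisedSpan hw
  · refine raisedSpan_le_comap_of_forall (fun u hu i k hk => ?_) hw
    rw [p_f_pow, ← End.mul_apply (ρ p), ← pow_succ']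
    exact sub_mem (f_pow_p_pow_mem_raisedSpan (by omega) hu i)
      (Submodule.smul_mem _ _ (f_pow_mem_raisedSpan (hqk hk hu) _))
  · refine raisedSpan_le_comap_of_forall (fun u hu i k hk => ?_) hw
    rw [q_f_pow]
    exact f_pow_mem_raisedSpan (hqk hk hu) _
  · refine raisedSpan_le_comap_of_forall (fun u hu i k hk => ?_) hw
    rw [z_f_pow, z_p_pow]
    exact f_pow_p_pow_mem_raisedSpan hk (hz u hu) i

theorem f_pow_p_pow_mem_iSup_eigenspace {n : ℕ} {u : E} (hu : u ∈ highestWeightSpace ρ n)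
    {i k : ℕ} (hik : i ≠ 0 ∨ k ≠ 0) :
    (ρ f ^ i) ((ρ p ^ k) u) ∈ ⨆ μ ≠ (n * (n + 2) + Complex.I * n : ℂ),
      (twistedCasimir ρ).eigenspace μ := by
  refine Submodule.mem_iSup_of_mem _ (Submodule.mem_iSup_of_mem ?_
    (f_pow_mem_eigenspace (p_pow_mem_highestWeightSpace hu k) i))
  intro hc
  have hre := congrArg Complex.re hc
  have him := congrArg Complex.im hc
  simp at hre him
  -- The real parts `(n + k) (n + k + 2)` and `n (n + 2)` differ by `k (2n + k + 2)`.
  have hk : k = 0 := by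
    have : (k : ℝ) * (2 * n + k + 2) = 0 := by linarith
    rcases mul_eq_zero.1 this with h | h
    · exact_mod_cast h
    · have : (0 : ℝ) < 2 * n + k + 2 := by positivity
      linarith
  subst hk
  simp at him
  tauto

theorem mem_eigenspace_of_mem_highestWeightSpace {n : ℕ} {u : E}
    (hu : u ∈ highestWeightSpace ρ n) :
    u ∈ (twistedCasimir ρ).eigenspace (n * (n + 2) + Complex.I * n) := by
  simpa using f_pow_mem_eigenspace hu 0

theorem raisedSpan_one_le {n : ℕ} {K : Submodule ℂ E} (hK : K ≤ highestWeightSpace ρ n) :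
    raisedSpan ρ K 1 ≤ ⨆ μ ≠ (n * (n + 2) + Complex.I * n : ℂ),
      (twistedCasimir ρ).eigenspace μ := by
  rw [raisedSpan, Submodule.span_le]
  rintro _ ⟨u, hu, i, k, hk, rfl⟩
  exact f_pow_p_pow_mem_iSup_eigenspace (hK hu) (Or.inr (by omega))

theorem highestWeightSpace_inf_raisedSpan_one {n : ℕ} {K : Submodule ℂ E}
    (hK : K ≤ highestWeightSpace ρ n) {x : E} (hx : x ∈ highestWeightSpace ρ n)
    (hx' : x ∈ raisedSpan ρ K 1) : x = 0 :=
  (Submodule.disjoint_def.1 ((End.eigenspaces_iSupIndep (twistedCasimir ρ)) _)) x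
    (mem_eigenspace_of_mem_highestWeightSpace hx) (raisedSpan_one_le hK hx')

theorem raisedSpan_zero_le {n : ℕ} {K : Submodule ℂ E} (hK : K ≤ highestWeightSpace ρ n) :
    raisedSpan ρ K 0 ≤ K ⊔ ⨆ μ ≠ (n * (n + 2) + Complex.I * n : ℂ),
      (twistedCasimir ρ).eigenspace μ := by
  rw [raisedSpan, Submodule.span_le]
  rintro _ ⟨u, hu, i, k, -, rfl⟩
  by_cases hik : i ≠ 0 ∨ k ≠ 0
  · exact Submodule.mem_sup_right (f_pow_p_pow_mem_iSup_eigenspace (hK hu) hik)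
  · obtain ⟨rfl, rfl⟩ : i = 0 ∧ k = 0 := by tauto
    exact Submodule.mem_sup_left hu

/-- Generators with `i` or `k` nonzero lie in other eigenspaces of the twisted Casimir operator, and
eigenspaces are independent. -/
theorem mem_of_mem_raisedSpan_zero {n : ℕ} {K : Submodule ℂ E}
    (hK : K ≤ highestWeightSpace ρ n) {x : E} (hx : x ∈ highestWeightSpace ρ n)
    (hx' : x ∈ raisedSpan ρ K 0) : x ∈ K := by
  obtain ⟨y, hy, y', hy', rfl⟩ := Submodule.mem_sup.1 (raisedSpan_zero_le hK hx')
  have hmem : y' ∈ highestWeightSpace ρ n := by simpa using sub_mem hx (hK hy)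
  have := (Submodule.disjoint_def.1 ((End.eigenspaces_iSupIndep (twistedCasimir ρ)) _)) y'
    (mem_eigenspace_of_mem_highestWeightSpace hmem) hy'
  simpa [this] using hy

end Representation

/-! ### Kernel and range of `T - b` for diagonalizable `T` -/

theorem inv_smul_smul_sub_smul_inv_smul {E : Type*} [AddCommGroup E] [Module ℂ E] {b c : ℂ}
    (hcb : c ≠ b) (x : E) : (c - b)⁻¹ • c • x - b • (c - b)⁻¹ • x = x := by
  rw [smul_smul, smul_smul, ← sub_smul, mul_comm b, ← mul_sub,
    inv_mul_cancel₀ (sub_ne_zero.2 hcb), one_smul]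

theorem ker_inf_range_sub_of_iSup_eigenspace {E : Type*} [AddCommGroup E] [Module ℂ E]
    {T : End ℂ E} (hT : ⨆ μ, T.eigenspace μ = ⊤) {b : ℂ} {x y : E} (hx : T x = b • x)
    (hxy : x = T y - b • y) : x = 0 := by
  have hmem (y : E) : T y - b • y ∈ ⨆ μ ≠ b, T.eigenspace μ := by
    have hy : y ∈ ⨆ μ, T.eigenspace μ := hT ▸ Submodule.mem_top
    induction hy using Submodule.iSup_induction' with
    | mem μ y hy =>
      rw [End.mem_eigenspace_iff.1 hy, ← sub_smul]
      by_cases hμ : μ = b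
      · simp [hμ]
      · exact Submodule.smul_mem _ _ (Submodule.mem_iSup_of_mem _ (Submodule.mem_iSup_of_mem hμ hy))
    | zero => simp
    | add y y' _ _ ih ih' =>
      convert add_mem ih ih' using 1
      rw [map_add, smul_add]
      abel
  exact Submodule.disjoint_def.1 (T.eigenspaces_iSupIndep b) x (End.mem_eigenspace_iff.2 hx)
    (hxy ▸ hmem y)

theorem exists_eq_add_sub_of_iSup_eigenspace {E : Type*} [AddCommGroup E] [Module ℂ E]
    {T : End ℂ E} (hT : ⨆ μ, T.eigenspace μ = ⊤) (b : ℂ) (x : E) :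
    ∃ y u, T y = b • y ∧ x = y + (T u - b • u) := by
  have hx : x ∈ ⨆ μ, T.eigenspace μ := hT ▸ Submodule.mem_top
  induction hx using Submodule.iSup_induction' with
  | mem μ x hx =>
    rw [End.mem_eigenspace_iff] at hx
    by_cases hμ : μ = b
    · exact ⟨x, 0, hμ ▸ hx, by simp⟩
    · refine ⟨0, (μ - b)⁻¹ • x, by simp, ?_⟩
      rw [map_smul, hx, inv_smul_smul_sub_smul_inv_smul hμ, zero_add]
  | zero => exact ⟨0, 0, by simp⟩
  | add x x' _ _ ih ih' =>
    obtain ⟨y, u, hy, rfl⟩ := ih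
    obtain ⟨y', u', hy', rfl⟩ := ih'
    refine ⟨y + y', u + u', by rw [map_add, hy, hy', smul_add], ?_⟩
    rw [map_add, smul_add]
    abel

/-! ### Integrable `sl₂`-modules -/

section Representation

variable {E : Type*} [AddCommGroup E] [Module ℂ E] (ρ : SchrodingerAlgebra →ₗ⁅ℂ⁆ End ℂ E)

/-- The vectors `f ^ i u` with `i ≤ m` and `u` a highest weight vector of weight `m` that generates
a finite-dimensional `sl₂`-module. -/
def stringVectors : Set E :=
  {x | ∃ m i : ℕ, ∃ u ∈ highestWeightSpace ρ m, i ≤ m ∧ (ρ f ^ (m + 1)) u = 0 ∧ x = (ρ f ^ i) u}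

variable {ρ}

theorem exists_f_pow_eq_zero (hs : Submodule.span ℂ (stringVectors ρ) = ⊤) (x : E) :
    ∃ N, (ρ f ^ N) x = 0 := by
  have hx : x ∈ Submodule.span ℂ (stringVectors ρ) := hs ▸ Submodule.mem_top
  induction hx using Submodule.span_induction with
  | mem x hx =>
    obtain ⟨m, i, u, -, -, hu, rfl⟩ := hx
    exact ⟨m + 1, by rw [← End.mul_apply, ← pow_add, add_comm, pow_add, End.mul_apply, hu, map_zero]⟩
  | zero => exact ⟨0, by simp⟩
  | add x y _ _ ihx ihy =>
    obtain ⟨N, hN⟩ := ihx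
    obtain ⟨M, hM⟩ := ihy
    have hx : (ρ f ^ (N + M)) x = 0 := by rw [add_comm, pow_add, End.mul_apply, hN, map_zero]
    have hy : (ρ f ^ (N + M)) y = 0 := by rw [pow_add, End.mul_apply, hM, map_zero]
    exact ⟨N + M, by rw [map_add, hx, hy, add_zero]⟩
  | smul c x _ ih =>
    obtain ⟨N, hN⟩ := ih
    exact ⟨N, by rw [map_smul, hN, smul_zero]⟩

theorem iSup_eigenspace_h (hs : Submodule.span ℂ (stringVectors ρ) = ⊤) :
    ⨆ μ, (ρ h).eigenspace μ = ⊤ := by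
  rw [eq_top_iff, ← hs, Submodule.span_le]
  rintro _ ⟨m, i, u, hu, -, -, rfl⟩
  exact Submodule.mem_iSup_of_mem _
    (End.mem_eigenspace_iff.2 (h_f_pow_of_h (mem_highestWeightSpace.1 hu).2 i))

/-- On an integrable `sl₂`-module, `e` maps the weight space of weight `n ≥ 0` onto that of
weight `n + 2`. -/
theorem exists_e_eq (hs : Submodule.span ℂ (stringVectors ρ) = ⊤) {n : ℕ} {x : E}
    (hx : ρ h x = ((n : ℂ) + 2) • x) : ∃ u, ρ h u = (n : ℂ) • u ∧ ρ e u = x := by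
  -- It suffices to solve modulo the range of `h - (n + 2)`: for `x` of weight `n + 2` the error
  -- lies in both kernel and range, so it vanishes.
  have hdec (x : E) : ∃ u y, ρ h u = (n : ℂ) • u ∧
      x = ρ e u + (ρ h y - ((n : ℂ) + 2) • y) := by
    have hx : x ∈ Submodule.span ℂ (stringVectors ρ) := hs ▸ Submodule.mem_top
    induction hx using Submodule.span_induction with
    | mem x hx =>
      obtain ⟨m, i, u, hu, him, -, rfl⟩ := hx
      have hw := h_f_pow_of_h (mem_highestWeightSpace.1 hu).2
      by_cases hmi : (m : ℂ) - 2 * i = n + 2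
      · have hne : ((i : ℂ) + 1) * (m - i) ≠ 0 := by
          refine mul_ne_zero (by exact_mod_cast i.succ_ne_zero) (sub_ne_zero.2 fun hc => ?_)
          have hc : m = i := by exact_mod_cast hc
          have : (n : ℂ) + 2 + i = 0 := by rw [← hmi, hc]; ring
          exact absurd this (by exact_mod_cast (n + 1 + i).succ_ne_zero ∘ fun h => by omega)
        refine ⟨(((i : ℂ) + 1) * (m - i))⁻¹ • (ρ f ^ (i + 1)) u, 0, ?_, ?_⟩
        · rw [map_smul, hw, smul_comm]
          congr 1
          push_cast
          linear_combination hmi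
        · rw [map_smul, e_f_pow_succ hu, inv_smul_smul₀ hne]
          simp
      · refine ⟨0, ((m : ℂ) - 2 * i - (n + 2))⁻¹ • (ρ f ^ i) u, by simp, ?_⟩
        rw [map_smul, hw, inv_smul_smul_sub_smul_inv_smul hmi, map_zero, zero_add]
    | zero => exact ⟨0, 0, by simp⟩
    | add x x' _ _ ih ih' =>
      obtain ⟨u, y, hu, rfl⟩ := ih
      obtain ⟨u', y', hu', rfl⟩ := ih'
      refine ⟨u + u', y + y', by rw [map_add, hu, hu', smul_add], ?_⟩
      rw [map_add, map_add, smul_add]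
      abel
    | smul c x _ ih =>
      obtain ⟨u, y, hu, rfl⟩ := ih
      refine ⟨c • u, c • y, by rw [map_smul, hu, smul_comm], ?_⟩
      rw [map_smul, map_smul, smul_add, smul_sub, smul_comm c ((n : ℂ) + 2)]
  obtain ⟨u, y, hu, hxy⟩ := hdec x
  refine ⟨u, hu, (sub_eq_zero.1 (ker_inf_range_sub_of_iSup_eigenspace (iSup_eigenspace_h hs)
    (b := n + 2) (x := x - ρ e u) (y := y) ?_ ?_)).symm⟩
  · rw [map_sub, hx, h_e_apply, hu, map_smul]
    module
  · rw [hxy]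
    abel

end Representation

/-! ### Harish-Chandra modules are integrable -/

section HarishChandra

theorem isSl2Triple_sl2 :
    IsSl2Triple (⟨h, by simp [sl2, h, basis_apply]⟩ : sl2)
      ⟨e, by simp [sl2, e, basis_apply]⟩ ⟨f, by simp [sl2, f, basis_apply]⟩ where
  h_ne_zero := by
    intro hc
    have := congrArg (fun x : sl2 => (x : SchrodingerAlgebra) 1) hc
    simp [h, basis_apply] at this
  lie_e_f := Subtype.ext lie_e_f
  lie_h_e_nsmul := Subtype.ext (by simp [lie_h_e, two_smul])
  lie_h_f_nsmul := Subtype.ext (by simp [lie_h_f, two_smul])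

variable {V : Type*} [AddCommGroup V] [Module ℂ V]
    [LieRingModule SchrodingerAlgebra V] [LieModule ℂ SchrodingerAlgebra V]

theorem coe_toEnd_pow (W : LieSubmodule ℂ sl2 V) (x : sl2) (i : ℕ) (w : W) :
    (((LieModule.toEnd ℂ sl2 W x) ^ i) w : V) =
      (LieModule.toEnd ℂ SchrodingerAlgebra V x ^ i) w := by
  induction i with
  | zero => rfl
  | succ i ih =>
    rw [pow_succ', pow_succ', End.mul_apply, End.mul_apply, ← ih]
    rfl

/-- The `f`-string of a primitive vector spans a nonzero `sl₂`-submodule, hence all of `W`, and it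
stops at `f ^ m`. -/
theorem le_span_stringVectors (W : LieSubmodule ℂ sl2 V) [LieModule.IsIrreducible ℂ sl2 W]
    [FiniteDimensional ℂ W] :
    W.toSubmodule ≤
      Submodule.span ℂ (stringVectors (LieModule.toEnd ℂ SchrodingerAlgebra V)) := by
  have : Nontrivial W := LieModule.nontrivial_of_isIrreducible ℂ sl2 W
  obtain ⟨μ, u, -, hu⟩ := (isSl2Triple_sl2).exists_hasPrimitiveVectorWith (R := ℂ) (M := W)
  obtain ⟨m, rfl⟩ := hu.exists_nat
  have hu0 := hu.pow_toEnd_f_eq_zero_of_eq_nat rfl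
  set F := LieModule.toEnd ℂ sl2 W ⟨f, by simp [sl2, f, basis_apply]⟩ with hF
  let S : Submodule ℂ W := Submodule.span ℂ (Set.range fun i : ℕ => (F ^ i) u)
  have hS : ∀ i, (F ^ i) u ∈ S := fun i => Submodule.subset_span ⟨i, rfl⟩
  have hstab : ∀ (x : sl2) (w : W), w ∈ S → ⁅x, w⁆ ∈ S := by
    intro x w hw
    induction hw using Submodule.span_induction with
    | mem w hw =>
      obtain ⟨i, rfl⟩ := hw
      have hx : x = (x : SchrodingerAlgebra) 0 • (⟨e, by simp [sl2, e, basis_apply]⟩ : sl2) +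
          (x : SchrodingerAlgebra) 1 • (⟨h, by simp [sl2, h, basis_apply]⟩ : sl2) +
          (x : SchrodingerAlgebra) 2 • (⟨f, by simp [sl2, f, basis_apply]⟩ : sl2) := by
        obtain ⟨x, h3, h4, h5⟩ := x
        refine Subtype.ext ((eq_sum_basis x).trans ?_)
        simp [h3, h4, h5]
      rw [hx]
      simp only [add_lie, smul_lie]
      refine add_mem (add_mem ?_ ?_) ?_ <;> refine Submodule.smul_mem _ _ ?_
      · cases i with
        | zero => simp [hu.lie_e]
        | succ i => rw [hu.lie_e_pow_succ_toEnd_f]; exact Submodule.smul_mem _ _ (hS i)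
      · rw [hu.lie_h_pow_toEnd_f]
        exact Submodule.smul_mem _ _ (hS i)
      · rw [hu.lie_f_pow_toEnd_f]
        exact hS (i + 1)
    | zero => simp
    | add w w' _ _ ih ih' => rw [lie_add]; exact add_mem ih ih'
    | smul c w _ ih => rw [lie_smul]; exact Submodule.smul_mem _ _ ih
  let N : LieSubmodule ℂ sl2 W := { S with lie_mem := fun {x w} hw => hstab x w hw }
  have hN : N = ⊤ := (eq_bot_or_eq_top N).resolve_left fun hN => by
    have hmem : u ∈ N := hS 0
    rw [hN] at hmem
    exact hu.ne_zero ((LieSubmodule.mem_bot u).1 hmem)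
  intro w hw
  have hw' : (⟨w, hw⟩ : W) ∈ S := by
    have hmem : (⟨w, hw⟩ : W) ∈ N := by rw [hN]; exact LieSubmodule.mem_top _
    exact hmem
  have hle : S ≤ (Submodule.span ℂ (stringVectors
      (LieModule.toEnd ℂ SchrodingerAlgebra V))).comap W.toSubmodule.subtype := by
    rw [Submodule.span_le]
    rintro _ ⟨i, rfl⟩
    change (((F ^ i) u : W) : V) ∈ Submodule.span ℂ _
    by_cases him : i ≤ m
    · refine Submodule.subset_span ⟨m, i, u, ?_, him, ?_, coe_toEnd_pow _ _ _ _⟩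
      · exact mem_highestWeightSpace.2
          ⟨congrArg Subtype.val hu.lie_e, congrArg Subtype.val hu.lie_h⟩
      · exact (coe_toEnd_pow _ _ _ _).symm.trans (congrArg Subtype.val hu0)
    · obtain ⟨j, rfl⟩ := Nat.exists_eq_add_of_lt (not_le.1 him)
      have : (F ^ (m + j + 1)) u = 0 := by
        rw [show m + j + 1 = j + (m + 1) by omega, pow_add, End.mul_apply, hu0, map_zero]
      rw [this]
      exact zero_mem _
  exact hle hw'

theorem span_stringVectors_eq_top (hV : IsHarishChandraModule sl2 V) :
    Submodule.span ℂ (stringVectors (LieModule.toEnd ℂ SchrodingerAlgebra V)) = ⊤ := by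
  obtain ⟨ι, W, hint, hW, -⟩ := hV
  classical
  rw [eq_top_iff, ← hint.submodule_iSup_eq_top, iSup_le_iff]
  intro i
  have := (hW i).1
  have := (hW i).2
  exact le_span_stringVectors (W i)

end HarishChandra

/-! ### Simple modules: lowest type and central character -/

section Representation

variable {E : Type*} [AddCommGroup E] [Module ℂ E] {ρ : SchrodingerAlgebra →ₗ⁅ℂ⁆ End ℂ E}

/-- The lowest `sl₂`-type of an integrable module. -/
theorem exists_lowest_highestWeight [Nontrivial E]
    (hs : Submodule.span ℂ (stringVectors ρ) = ⊤) :
    ∃ n : ℕ, (∃ v ∈ highestWeightSpace ρ n, v ≠ 0) ∧ ∀ u ∈ highestWeightSpace ρ (n - 1), u = 0 := by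
  classical
  have hex : ∃ n : ℕ, ∃ v ∈ highestWeightSpace ρ n, v ≠ 0 := by
    by_contra! hc
    have : (⊤ : Submodule ℂ E) = ⊥ := by
      rw [← hs, Submodule.span_eq_bot]
      rintro _ ⟨m, i, u, hu, -, -, rfl⟩
      rw [hc m u hu, map_zero]
    exact top_ne_bot this
  refine ⟨Nat.find hex, Nat.find_spec hex, fun u hu => ?_⟩
  by_contra hne
  obtain ⟨N, hN⟩ := exists_f_pow_eq_zero hs u
  -- Integrability forces `n - 1` to be a natural number, against minimality; this also covers `n =
  -- 0`, where the weight is `-1`.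
  refine hne (eq_zero_of_f_pow_eq_zero hu (fun m hm => ?_) hN)
  have hm' : Nat.find hex = m + 1 := by
    have : (Nat.find hex : ℂ) = m + 1 := by rw [← hm]; ring
    exact_mod_cast this
  exact Nat.find_min hex (m := m) (by omega) ⟨u, hm ▸ hu, hne⟩

theorem q_eq_of_highestWeightSpace_eq_bot {n : ℕ}
    (hn : ∀ u ∈ highestWeightSpace ρ (n - 1), u = 0) {u : E} (hu : u ∈ highestWeightSpace ρ n) :
    ((n : ℂ) + 1) • ρ q u = ρ f (ρ p u) := by
  obtain ⟨he, hh⟩ := mem_highestWeightSpace.1 hu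
  refine sub_eq_zero.1 (hn _ (mem_highestWeightSpace.2 ⟨?_, ?_⟩))
  · rw [map_sub, map_smul, e_q_apply, e_f_apply, e_p_apply, h_p_apply, he, hh]
    simp only [map_zero, map_smul]
    module
  · rw [map_sub, map_smul, h_q_apply, h_f_apply, h_p_apply, hh]
    simp only [map_smul, map_add]
    module

/-- The representation has no proper nonzero invariant subspace. -/
def HasNoProperInvariant (ρ : SchrodingerAlgebra →ₗ⁅ℂ⁆ End ℂ E) : Prop :=
  ∀ S : Submodule ℂ E, (∀ x, ∀ w ∈ S, ρ x w ∈ S) → S = ⊥ ∨ S = ⊤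

theorem HasNoProperInvariant.eq_zero_or_isUnit (hirr : HasNoProperInvariant ρ) {T : End ℂ E}
    (hT : ∀ x w, T (ρ x w) = ρ x (T w)) : T = 0 ∨ IsUnit T := by
  rcases hirr (LinearMap.ker T) (fun x w hw => by
    rw [LinearMap.mem_ker] at hw ⊢; rw [hT, hw, map_zero]) with hk | hk
  · rcases hirr (LinearMap.range T) (by rintro x _ ⟨w, rfl⟩; exact ⟨ρ x w, hT x w⟩) with hr | hr
    · exact Or.inl (LinearMap.range_eq_bot.1 hr)
    · exact Or.inr ((End.isUnit_iff T).2 ⟨LinearMap.ker_eq_bot.1 hk, LinearMap.range_eq_top.1 hr⟩)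
  · exact Or.inl (LinearMap.ker_eq_top.1 hk)

theorem HasNoProperInvariant.eq_zero (hirr : HasNoProperInvariant ρ) {T : End ℂ E}
    (hT : ∀ x w, T (ρ x w) = ρ x (T w)) {v : E} (hv : v ≠ 0) (hTv : T v = 0) : T = 0 :=
  (hirr.eq_zero_or_isUnit hT).resolve_right fun hu =>
    hv (((End.isUnit_iff T).1 hu).1 (hTv.trans (map_zero T).symm))

theorem aeval_commute {T : End ℂ E} (hT : ∀ x w, T (ρ x w) = ρ x (T w)) (P : Polynomial ℂ)
    (x : SchrodingerAlgebra) (w : E) :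
    Polynomial.aeval T P (ρ x w) = ρ x (Polynomial.aeval T P w) := by
  induction P using Polynomial.induction_on' generalizing w with
  | add P Q hP hQ => simp [hP, hQ]
  | monomial k a =>
    have (k : ℕ) (w : E) : (T ^ k) (ρ x w) = ρ x ((T ^ k) w) := by
      induction k generalizing w with
      | zero => rfl
      | succ k ih => rw [pow_succ, End.mul_apply, hT, ih, End.mul_apply]
    simp [Polynomial.aeval_monomial, this, Algebra.algebraMap_eq_smul_one]

/-- By Schur's lemma `P(T)` vanishes everywhere. As `P` splits over `ℂ`, some `T - c` is not
invertible, hence zero. -/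
theorem HasNoProperInvariant.exists_eq_smul_one (hirr : HasNoProperInvariant ρ) {T : End ℂ E}
    (hT : ∀ x w, T (ρ x w) = ρ x (T w)) {P : Polynomial ℂ} (hP : P ≠ 0) {v : E} (hv : v ≠ 0)
    (hPv : Polynomial.aeval T P v = 0) : ∃ c : ℂ, T = c • 1 := by
  have h0 : Polynomial.aeval T P = 0 := hirr.eq_zero (aeval_commute hT P) hv hPv
  have : Nontrivial (End ℂ E) := ⟨1, 0, fun hc => hv (by simpa using LinearMap.congr_fun hc v)⟩
  have hsplit := (IsAlgClosed.splits P).eq_prod_roots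
  have hprod : ¬ IsUnit (Polynomial.aeval T (P.roots.map fun a => Polynomial.X - Polynomial.C a).prod) := by
    intro hu
    rw [hsplit, map_mul, Polynomial.aeval_C, Algebra.algebraMap_eq_smul_one, smul_mul_assoc,
      one_mul, smul_eq_zero] at h0
    rcases h0 with h0 | h0
    · exact hP (Polynomial.leadingCoeff_eq_zero.1 h0)
    · exact hu.ne_zero h0
  obtain ⟨c, hc, -⟩ := spectrum.exists_mem_of_not_isUnit_aeval_prod hprod
  refine ⟨c, ?_⟩
  have := (hirr.eq_zero_or_isUnit (T := algebraMap ℂ (End ℂ E) c - T) (fun x w => by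
    simp [hT])).resolve_right (spectrum.mem_iff.1 hc)
  rw [← sub_eq_zero.1 this, Algebra.algebraMap_eq_smul_one]

theorem raisedSpan_zero_eq_top (hirr : HasNoProperInvariant ρ) {n : ℕ}
    (hn : ∀ u ∈ highestWeightSpace ρ (n - 1), u = 0) {K : Submodule ℂ E}
    (hK : K ≤ highestWeightSpace ρ n) (hz : ∀ u ∈ K, ρ z u ∈ K) (hK0 : K ≠ ⊥) :
    raisedSpan ρ K 0 = ⊤ := by
  refine (hirr _ fun x w hw => raisedSpan_stable hK hz
    (fun u hu => q_eq_of_highestWeightSpace_eq_bot hn (hK hu)) (Or.inl rfl) x hw).resolve_left ?_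
  intro hbot
  refine hK0 ((Submodule.eq_bot_iff _).2 fun u hu => ?_)
  exact (Submodule.mem_bot ℂ).1 (hbot ▸ p_pow_mem_raisedSpan (k := 0) le_rfl hu)

theorem highestWeightSpace_le (hirr : HasNoProperInvariant ρ) {n : ℕ}
    (hn : ∀ u ∈ highestWeightSpace ρ (n - 1), u = 0) {K : Submodule ℂ E}
    (hK : K ≤ highestWeightSpace ρ n) (hz : ∀ u ∈ K, ρ z u ∈ K) (hK0 : K ≠ ⊥) :
    highestWeightSpace ρ n ≤ K := fun _ hx =>
  mem_of_mem_raisedSpan_zero hK hx (raisedSpan_zero_eq_top hirr hn hK hz hK0 ▸ Submodule.mem_top)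

/-- If `z` acts by zero, the vectors with `k ≥ 1` span an invariant subspace missing `v`, hence
zero. Then finitely many `f ^ i v` span `E`. -/
theorem z_ne_zero (hirr : HasNoProperInvariant ρ) (hinf : ¬ FiniteDimensional ℂ E)
    (hs : Submodule.span ℂ (stringVectors ρ) = ⊤) {n : ℕ}
    (hn : ∀ u ∈ highestWeightSpace ρ (n - 1), u = 0) {v : E} (hv : v ∈ highestWeightSpace ρ n)
    (hv0 : v ≠ 0) : ρ z ≠ 0 := by
  intro hz0
  have hK : Submodule.span ℂ {v} ≤ highestWeightSpace ρ n := by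
    rwa [Submodule.span_singleton_le_iff_mem]
  have hz : ∀ u ∈ Submodule.span ℂ {v}, ρ z u ∈ Submodule.span ℂ {v} := by simp [hz0]
  have hvK := Submodule.mem_span_singleton_self (R := ℂ) v
  have htop := raisedSpan_zero_eq_top hirr hn hK hz (by simpa using hv0)
  have hbot : raisedSpan ρ (Submodule.span ℂ {v}) 1 = ⊥ := by
    refine (hirr _ fun x w hw => raisedSpan_stable hK hz
      (fun u hu => q_eq_of_highestWeightSpace_eq_bot hn (hK hu)) (Or.inr hz0) x hw).resolve_right ?_
    intro htop'
    exact hv0 (highestWeightSpace_inf_raisedSpan_one hK hv (htop' ▸ Submodule.mem_top))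
  obtain ⟨N, hN⟩ := exists_f_pow_eq_zero hs v
  refine hinf (Module.finite_def.2 (htop ▸ Submodule.fg_def.2
    ⟨Set.range fun i : Fin N => (ρ f ^ (i : ℕ)) v, Set.finite_range _, le_antisymm ?_ ?_⟩))
  · exact htop ▸ le_top
  · rw [raisedSpan, Submodule.span_le]
    rintro _ ⟨u, hu, i, k, -, rfl⟩
    rcases k with _ | k
    · obtain ⟨a, rfl⟩ := Submodule.mem_span_singleton.1 hu
      rw [pow_zero, End.one_apply, map_smul]
      refine Submodule.smul_mem _ _ ?_
      by_cases hi : i < N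
      · exact Submodule.subset_span ⟨⟨i, hi⟩, rfl⟩
      · obtain ⟨j, rfl⟩ := Nat.exists_eq_add_of_le (not_lt.1 hi)
        rw [add_comm, pow_add, End.mul_apply, hN, map_zero]
        exact zero_mem _
    · have := p_pow_mem_raisedSpan (ρ := ρ) (k₀ := 1) (k := k + 1) (by omega) hu
      rw [hbot, Submodule.mem_bot] at this
      rw [this, map_zero]
      exact zero_mem _

/-- The center acts on a simple infinite-dimensional integrable module by a nonzero scalar, and
the lowest `sl₂`-type has multiplicity one. -/
theorem exists_central_character (hirr : HasNoProperInvariant ρ)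
    (hinf : ¬ FiniteDimensional ℂ E) (hs : Submodule.span ℂ (stringVectors ρ) = ⊤) {n : ℕ}
    (hn : ∀ u ∈ highestWeightSpace ρ (n - 1), u = 0) {v : E} (hv : v ∈ highestWeightSpace ρ n)
    (hv0 : v ≠ 0) :
    (∃ c : ℂ, c ≠ 0 ∧ ρ z = c • 1) ∧ highestWeightSpace ρ n ≤ Submodule.span ℂ {v} := by
  have hz0 := z_ne_zero hirr hinf hs hn hv hv0
  have hcomm : ∀ x w, ρ z (ρ x w) = ρ x (ρ z w) := z_apply ρ
  have hscalar : ∃ c : ℂ, ρ z = c • 1 := by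
    obtain ⟨Z, hZ⟩ := (End.isUnit_iff _).1 ((hirr.eq_zero_or_isUnit hcomm).resolve_left hz0)
    -- `K = ℂ[z] v` is `z`-stable, so it contains every highest weight vector of weight `n`, in
    -- particular `w = z⁻¹ v`. Writing `w = P(z) v`, the polynomial `X P - 1` kills `v`; it is
    -- nonzero since its value at `0` is `-1`.
    let K : Submodule ℂ E := LinearMap.range
      (LinearMap.applyₗ v ∘ₗ (Polynomial.aeval (ρ z)).toLinearMap)
    have hvK : v ∈ K := ⟨1, by simp⟩
    have hK : K ≤ highestWeightSpace ρ n := by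
      rintro _ ⟨P, rfl⟩
      obtain ⟨he, hh⟩ := mem_highestWeightSpace.1 hv
      refine mem_highestWeightSpace.2 ⟨?_, ?_⟩
      · simp [← aeval_commute hcomm, he]
      · simp [← aeval_commute hcomm, hh]
    have hKz : ∀ u ∈ K, ρ z u ∈ K := by
      rintro _ ⟨P, rfl⟩
      exact ⟨Polynomial.X * P, by simp⟩
    have hle := highestWeightSpace_le hirr hn hK hKz (fun hb => hv0 (by simpa [hb] using hvK))
    obtain ⟨w, hw⟩ := hZ v
    have hwhw : w ∈ highestWeightSpace ρ n := by
      obtain ⟨he, hh⟩ := mem_highestWeightSpace.1 hv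
      refine mem_highestWeightSpace.2 ⟨Z ?_, Z ?_⟩
      · rw [z_apply, hw, he, map_zero]
      · rw [z_apply, hw, hh, map_smul, hw]
    obtain ⟨P, hP⟩ := hle hwhw
    refine hirr.exists_eq_smul_one hcomm (P := Polynomial.X * P - 1) ?_ hv0 ?_
    · intro hc
      have := congrArg (Polynomial.eval 0) hc
      simp at this
    · have hP : Polynomial.aeval (ρ z) P v = w := hP
      simp [hP, hw]
  obtain ⟨c, hc⟩ := hscalar
  refine ⟨⟨c, fun h0 => hz0 (by rw [hc, h0, zero_smul]), hc⟩, ?_⟩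
  refine highestWeightSpace_le hirr hn ?_ ?_ ?_
  · rwa [Submodule.span_singleton_le_iff_mem]
  · intro u hu
    rw [hc]
    exact Submodule.smul_mem _ _ hu
  · simpa using hv0

theorem exists_eq_smul_one_of_commute (hirr : HasNoProperInvariant ρ) {μ : ℂ} {v : E}
    (hv : v ∈ highestWeightSpace ρ μ) (hv0 : v ≠ 0)
    (hle : highestWeightSpace ρ μ ≤ Submodule.span ℂ {v}) {T : End ℂ E}
    (hT : ∀ x w, T (ρ x w) = ρ x (T w)) : ∃ a : ℂ, T = a • 1 := by
  obtain ⟨he, hh⟩ := mem_highestWeightSpace.1 hv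
  obtain ⟨a, ha⟩ := Submodule.mem_span_singleton.1 (hle (x := T v)
    (mem_highestWeightSpace.2 ⟨by rw [← hT, he, map_zero], by rw [← hT, hh, map_smul]⟩))
  refine ⟨a, sub_eq_zero.1 (hirr.eq_zero (fun x w => ?_) hv0 ?_)⟩
  · simp [hT]
  · simp [ha]

end Representation

/-! ### Cocycles and splitting of self-extensions -/

section Representation

variable {E : Type*} [AddCommGroup E] [Module ℂ E] {ρ : SchrodingerAlgebra →ₗ⁅ℂ⁆ End ℂ E}

theorem h_f_pow_of_h_add {μ : ℂ} {w t : E} (hw : ρ h w = μ • w + t) (i : ℕ) :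
    ρ h ((ρ f ^ i) w) = (μ - 2 * i) • (ρ f ^ i) w + (ρ f ^ i) t := by
  induction i with
  | zero => simpa using hw
  | succ i ih =>
    rw [pow_succ', End.mul_apply, End.mul_apply, h_f_apply, ih, map_add, map_smul]
    push_cast
    module

theorem e_f_pow_succ_of_h_add {μ : ℂ} {w t : E} (he : ρ e w = 0) (hw : ρ h w = μ • w + t)
    (i : ℕ) : ρ e ((ρ f ^ (i + 1)) w) =
      ((i + 1) * (μ - i)) • (ρ f ^ i) w + ((i : ℂ) + 1) • (ρ f ^ i) t := by
  induction i with
  | zero => simp [e_f_apply, he, hw]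
  | succ i ih =>
    rw [pow_succ', End.mul_apply, e_f_apply, ih, h_f_pow_of_h_add hw, map_add, map_smul, map_smul,
      ← End.mul_apply, ← End.mul_apply, ← pow_succ']
    push_cast
    module

variable (ρ) in
/-- The 1-cocycles of the Schrödinger algebra with values in `End E`. -/
def IsCocycle (φ : SchrodingerAlgebra →ₗ[ℂ] End ℂ E) : Prop :=
  ∀ x y w, φ ⁅x, y⁆ w =
    ρ x (φ y w) - φ y (ρ x w) - (ρ y (φ x w) - φ x (ρ y w))

/-- The extension of `ρ` by itself attached to a cocycle. -/
noncomputable def IsCocycle.extension {φ : SchrodingerAlgebra →ₗ[ℂ] End ℂ E}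
    (hφ : IsCocycle ρ φ) : SchrodingerAlgebra →ₗ⁅ℂ⁆ End ℂ (E × E) where
  toFun x := (ρ x ∘ₗ LinearMap.fst ℂ E E).prod
    (ρ x ∘ₗ LinearMap.snd ℂ E E + φ x ∘ₗ LinearMap.fst ℂ E E)
  map_add' x y := by
    ext w <;> simp
  map_smul' c x := by
    ext w <;> simp
  map_lie' {x y} := by
    refine LinearMap.ext fun w => Prod.ext ?_ ?_
    · simp [Ring.lie_def]
    · change ρ ⁅x, y⁆ w.2 + φ ⁅x, y⁆ w.1 = ρ x (ρ y w.2 + φ y w.1) + φ x (ρ y w.1) -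
        (ρ y (ρ x w.2 + φ x w.1) + φ y (ρ x w.1))
      rw [hφ x y, map_add, map_add, apply_apply ρ x y]
      abel

variable {φ : SchrodingerAlgebra →ₗ[ℂ] End ℂ E}

theorem IsCocycle.extension_apply (hφ : IsCocycle ρ φ) (x : SchrodingerAlgebra) (w : E × E) :
    hφ.extension x w = (ρ x w.1, ρ x w.2 + φ x w.1) := rfl

theorem IsCocycle.extension_apply_inr (hφ : IsCocycle ρ φ) (x : SchrodingerAlgebra) (u : E) :
    hφ.extension x (0, u) = (0, ρ x u) := by
  simp [extension_apply]

theorem IsCocycle.extension_pow_apply_inr (hφ : IsCocycle ρ φ) (x : SchrodingerAlgebra) (u : E) (i : ℕ) :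
    (hφ.extension x ^ i) (0, u) = (0, (ρ x ^ i) u) := by
  induction i with
  | zero => rfl
  | succ i ih => rw [pow_succ', End.mul_apply, ih, extension_apply_inr, pow_succ', End.mul_apply]

theorem IsCocycle.extension_pow_apply_fst (hφ : IsCocycle ρ φ) (x : SchrodingerAlgebra) (w : E × E) (i : ℕ) :
    ((hφ.extension x ^ i) w).1 = (ρ x ^ i) w.1 := by
  induction i with
  | zero => rfl
  | succ i ih => rw [pow_succ', End.mul_apply, extension_apply, ih, pow_succ', End.mul_apply]

/-- Highest weight vectors lift along extensions of integrable modules. -/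
theorem IsCocycle.exists_lift_highestWeight (hφ : IsCocycle ρ φ)
    (hs : Submodule.span ℂ (stringVectors ρ) = ⊤) {n : ℕ} {v : E} (hv : v ∈ highestWeightSpace ρ n) :
    ∃ u, (v, u) ∈ highestWeightSpace hφ.extension n := by
  have hdiag := iSup_eigenspace_h hs
  obtain ⟨he, hh⟩ := mem_highestWeightSpace.1 hv
  -- The part of `φ h v` in the range of `h - n` is absorbed by changing the lift; what remains is
  -- an error `y` of weight `n`.
  obtain ⟨y, u₀, hy, hu₀⟩ := exists_eq_add_sub_of_iSup_eigenspace hdiag (n : ℂ) (φ h v)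
  have hw₀ : hφ.extension h (v, -u₀) = (n : ℂ) • (v, -u₀) + (0, y) := by
    rw [extension_apply, hu₀, hh]
    ext
    · simp
    · simp only [map_neg, Prod.snd_add, Prod.smul_snd]
      module
  obtain ⟨x, hx⟩ : ∃ x, hφ.extension e (v, -u₀) = (0, x) :=
    ⟨_, by rw [extension_apply, he]⟩
  have hhx : ρ h x = ((n : ℂ) + 2) • x + ρ e y := by
    have := h_e_apply hφ.extension (v, -u₀)
    rw [hw₀, map_add, map_smul, hx, extension_apply_inr, extension_apply_inr] at this
    have := congrArg Prod.snd this
    simp only [Prod.snd_add, Prod.smul_snd] at this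
    rw [this]
    module
  -- `e y` has weight `n + 2` and equals `(h - (n + 2)) x`, so diagonalizability of `h` kills it.
  have hey : ρ e y = 0 := by
    refine ker_inf_range_sub_of_iSup_eigenspace hdiag (b := n + 2) (y := x) ?_ ?_
    · rw [h_e_apply, hy, map_smul]
      module
    · rw [hhx, add_sub_cancel_left]
  rw [hey, add_zero] at hhx
  obtain ⟨u₁, hu₁, hu₁x⟩ := exists_e_eq hs hhx
  set w : E × E := (v, -u₀ - u₁) with hw
  have hw' : w = (v, -u₀) - (0, u₁) := by simp [hw]
  have hwe : hφ.extension e w = 0 := by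
    rw [hw', map_sub, hx, extension_apply_inr, hu₁x, sub_self]
  have hwh : hφ.extension h w = (n : ℂ) • w + (0, y) := by
    rw [hw', map_sub, hw₀, extension_apply_inr, hu₁, smul_sub]
    ext
    · simp
    · simp only [Prod.snd_sub, Prod.snd_add, Prod.smul_snd]
      abel
  have hymem : y ∈ highestWeightSpace ρ n := mem_highestWeightSpace.2 ⟨hey, hy⟩
  have hfn {u : E} (hu : u ∈ highestWeightSpace ρ n) : (ρ f ^ (n + 1)) u = 0 := by
    obtain ⟨N, hN⟩ := exists_f_pow_eq_zero hs u
    exact f_pow_succ_eq_zero hu hN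
  -- It remains to show `y = 0`. Since `s` has weight `-(n + 2)` and `f e s = 0`, it vanishes; then
  -- `e s = (n + 1) f ^ n y` gives `f ^ n y = 0`, and `f ^ n` is injective on highest weight vectors
  -- of weight `n`.
  obtain ⟨s, hws⟩ : ∃ s, (hφ.extension f ^ (n + 1)) w = (0, s) :=
    ⟨_, Prod.ext ((hφ.extension_pow_apply_fst f w (n + 1)).trans (hfn hv)) rfl⟩
  have hes : ρ e s = ((n : ℂ) + 1) • (ρ f ^ n) y := by
    have := e_f_pow_succ_of_h_add hwe hwh n
    rw [hws, extension_apply_inr, extension_pow_apply_inr] at this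
    simpa using congrArg Prod.snd this
  have hhs : ρ h s = (-((n : ℂ) + 2)) • s := by
    have := h_f_pow_of_h_add hwh (n + 1)
    rw [hws, extension_apply_inr, extension_pow_apply_inr, hfn hymem] at this
    have := congrArg Prod.snd this
    simp only [Prod.snd_add, Prod.smul_snd, add_zero] at this
    rw [this]
    congr 1
    push_cast
    ring
  obtain ⟨N, hN⟩ := exists_f_pow_eq_zero hs s
  have hs0 : s = 0 := by
    refine eq_zero_of_f_e_of_f_pow hhs ?_ (fun m hm => ?_) hN
    · rw [hes, map_smul, ← End.mul_apply, ← pow_succ', hfn hymem, smul_zero]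
    · have : (m : ℂ) + n + 2 = 0 := by rw [← hm]; ring
      exact absurd this (by exact_mod_cast (m + n + 1).succ_ne_zero)
  have hy0 : y = 0 := by
    refine eq_zero_of_f_pow_nat_eq_zero hymem le_rfl ?_
    rw [hs0, map_zero, eq_comm, smul_eq_zero] at hes
    exact hes.resolve_left (by exact_mod_cast n.succ_ne_zero)
  exact ⟨_, mem_highestWeightSpace.2 ⟨hwe, by rw [hwh, hy0, Prod.mk_zero_zero, add_zero]⟩⟩

/-- The lifted vector `(v, u)` generates an invariant subspace `M` whose highest weight vectors of
weight `n` are multiples of `(v, u)`. So `M` does not contain `(0, v)`, meets `0 × E` trivially and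
projects onto `E`: it is the graph of a linear map, and its invariance is the commutator identity.
-/
theorem IsCocycle.exists_eq_commutator (hφ : IsCocycle ρ φ) (hirr : HasNoProperInvariant ρ)
    (hs : Submodule.span ℂ (stringVectors ρ) = ⊤) {n : ℕ}
    (hn : ∀ u ∈ highestWeightSpace ρ (n - 1), u = 0) {v : E} (hv : v ∈ highestWeightSpace ρ n)
    (hv0 : v ≠ 0) {c : ℂ} (hc : ρ z = c • 1) (hφz : φ z = 0) :
    ∃ T : End ℂ E, ∀ x w, φ x w = ρ x (T w) - T (ρ x w) := by
  obtain ⟨u, hw⟩ := hφ.exists_lift_highestWeight hs hv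
  have hinr {μ : ℂ} {b : E} :
      ((0, b) : E × E) ∈ highestWeightSpace hφ.extension μ ↔ b ∈ highestWeightSpace ρ μ := by
    simp [mem_highestWeightSpace, extension_apply_inr]
  have hn' : ∀ w ∈ highestWeightSpace hφ.extension (n - 1), w = 0 := by
    rintro ⟨a, b⟩ hab
    have ha : a = 0 := hn a (mem_highestWeightSpace.2
      ⟨congrArg Prod.fst (mem_highestWeightSpace.1 hab).1,
        congrArg Prod.fst (mem_highestWeightSpace.1 hab).2⟩)
    subst ha
    rw [hn b (hinr.1 hab), Prod.mk_zero_zero]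
  set K : Submodule ℂ (E × E) := Submodule.span ℂ {(v, u)} with hKdef
  have hK : K ≤ highestWeightSpace hφ.extension n := by
    rwa [hKdef, Submodule.span_singleton_le_iff_mem]
  have hKz : ∀ w ∈ K, hφ.extension z w ∈ K := by
    intro w hw
    have : hφ.extension z w = c • w := by
      rw [extension_apply, hc, hφz]
      ext <;> simp
    rw [this]
    exact Submodule.smul_mem _ _ hw
  set M := raisedSpan hφ.extension K 0 with hM
  have hstab : ∀ x, ∀ w ∈ M, hφ.extension x w ∈ M := fun x w hw =>
    raisedSpan_stable hK hKz (fun u hu => q_eq_of_highestWeightSpace_eq_bot hn' (hK hu))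
      (Or.inl rfl) x hw
  have hvM : (v, u) ∈ M := p_pow_mem_raisedSpan (k := 0) le_rfl (Submodule.mem_span_singleton_self _)
  have hbot : M.comap (LinearMap.inr ℂ E E) = ⊥ := by
    refine (hirr _ fun x b hb => ?_).resolve_right fun htop => ?_
    · have := hstab x _ hb
      rwa [LinearMap.inr_apply, extension_apply_inr] at this
    · have hmem : (0, v) ∈ M := (htop ▸ Submodule.mem_top : v ∈ M.comap (LinearMap.inr ℂ E E))
      obtain ⟨a, ha⟩ := Submodule.mem_span_singleton.1
        (mem_of_mem_raisedSpan_zero hK (hinr.2 hv) hmem)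
      have ha1 : a • v = 0 := congrArg Prod.fst ha
      have ha2 : a • u = v := congrArg Prod.snd ha
      rcases smul_eq_zero.1 ha1 with h0 | h0
      · exact hv0 (by rw [← ha2, h0, zero_smul])
      · exact hv0 h0
  have htop : M.map (LinearMap.fst ℂ E E) = ⊤ := by
    refine (hirr _ ?_).resolve_left fun hb => ?_
    · rintro x _ ⟨w, hw, rfl⟩
      exact ⟨_, hstab x w hw, rfl⟩
    · exact hv0 ((Submodule.mem_bot ℂ).1 (hb ▸ ⟨_, hvM, rfl⟩))
  have hinj : ∀ b, (0, b) ∈ M → b = 0 := fun b hb =>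
    (Submodule.mem_bot ℂ).1 (hbot ▸ (hb : b ∈ M.comap (LinearMap.inr ℂ E E)))
  let π : M →ₗ[ℂ] E := LinearMap.fst ℂ E E ∘ₗ M.subtype
  have hπ : Function.Bijective π := by
    refine ⟨?_, fun a => ?_⟩
    · rw [← LinearMap.ker_eq_bot, Submodule.eq_bot_iff]
      rintro ⟨⟨a, b⟩, hab⟩ (ha : a = 0)
      subst ha
      exact Subtype.ext (Prod.ext rfl (hinj b hab))
    · obtain ⟨w, hw, rfl⟩ := (htop ▸ Submodule.mem_top : a ∈ M.map (LinearMap.fst ℂ E E))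
      exact ⟨⟨w, hw⟩, rfl⟩
  let T : End ℂ E := LinearMap.snd ℂ E E ∘ₗ M.subtype ∘ₗ (LinearEquiv.ofBijective π hπ).symm
  have hT : ∀ a, (a, T a) ∈ M := by
    intro a
    have h1 : (((LinearEquiv.ofBijective π hπ).symm a : M) : E × E).1 = a :=
      (LinearEquiv.ofBijective π hπ).apply_symm_apply a
    have h2 := ((LinearEquiv.ofBijective π hπ).symm a).2
    rwa [show (((LinearEquiv.ofBijective π hπ).symm a : M) : E × E) = (a, T a) from
      Prod.ext h1 rfl] at h2
  refine ⟨-T, fun x w => ?_⟩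
  have h1 := sub_mem (hstab x _ (hT w)) (hT (ρ x w))
  rw [extension_apply, Prod.mk_sub_mk, sub_self] at h1
  have := hinj _ h1
  rw [LinearMap.neg_apply, LinearMap.neg_apply, map_neg]
  rw [sub_eq_zero] at this
  rw [← this]
  abel

end Representation

end SchrodingerAlgebra

/-! ### `Ext¹` from a projective presentation -/

section Ext

open CategoryTheory Abelian

universe w v u

/-- The connecting map `Hom(X₁, Y) → Ext¹(X₃, Y)` of a short exact sequence, as a linear map. -/
noncomputable def CategoryTheory.ShortComplex.ShortExact.connectingHom (k : Type*) [CommRing k]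
    {C : Type u} [Category.{v} C] [Abelian C] [HasExt.{w} C] [Linear k C] {S : ShortComplex C}
    (hS : S.ShortExact) (Y : C) : (S.X₁ ⟶ Y) →ₗ[k] Ext S.X₃ Y 1 :=
  (hS.extClass.precompOfLinear k Y (add_zero 1)) ∘ₗ (Ext.linearEquiv₀ (R := k)).symm.toLinearMap

variable {k : Type*} [CommRing k] {C : Type u} [Category.{v} C] [Abelian C] [HasExt.{w} C]
  [Linear k C] {S : ShortComplex C}

theorem CategoryTheory.ShortComplex.ShortExact.connectingHom_apply (hS : S.ShortExact) (Y : C)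
    (f : S.X₁ ⟶ Y) :
    hS.connectingHom k Y f = hS.extClass.comp (Ext.mk₀ f) (add_zero 1) := by
  simp [connectingHom]

theorem CategoryTheory.ShortComplex.ShortExact.connectingHom_surjective (hS : S.ShortExact) (Y : C)
    [Projective S.X₂] :
    Function.Surjective (hS.connectingHom k Y) := by
  intro x
  obtain ⟨y, hy⟩ := Ext.contravariant_sequence_exact₃ hS Y x (Ext.eq_zero_of_projective _)
    (add_zero 1)
  exact ⟨Ext.linearEquiv₀ (R := k) y, by rw [connectingHom_apply, Ext.mk₀_linearEquiv₀_apply, hy]⟩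

theorem CategoryTheory.ShortComplex.ShortExact.connectingHom_eq_zero_iff (hS : S.ShortExact) (Y : C)
    (f : S.X₁ ⟶ Y) :
    hS.connectingHom k Y f = 0 ↔ ∃ g : S.X₂ ⟶ Y, S.f ≫ g = f := by
  rw [connectingHom_apply]
  constructor
  · intro h
    obtain ⟨y, hy⟩ := Ext.contravariant_sequence_exact₁ hS Y (Ext.mk₀ f) (add_zero 1) h
    refine ⟨Ext.linearEquiv₀ (R := k) y, (Ext.linearEquiv₀ (R := k)).symm.injective ?_⟩
    simp only [Ext.linearEquiv₀_symm_apply, ← hy, ← Ext.mk₀_comp_mk₀, Ext.mk₀_linearEquiv₀_apply]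
  · rintro ⟨g, rfl⟩
    simp [← Ext.mk₀_comp_mk₀]

/-- A functional on `Hom(X₁, Y)` vanishing exactly on the morphisms that extend to the projective
object `X₂` identifies `Ext¹(X₃, Y)` with the ring of scalars. -/
theorem CategoryTheory.ShortComplex.ShortExact.nonempty_ext_linearEquiv (hS : S.ShortExact) (Y : C)
    [Projective S.X₂]
    (ζ : (S.X₁ ⟶ Y) → k) (hadd : ∀ f g, ζ (f + g) = ζ f + ζ g)
    (hsmul : ∀ (a : k) f, ζ (a • f) = a * ζ f) (hζ : Function.Surjective ζ)
    (hker : ∀ f, ζ f = 0 ↔ ∃ g : S.X₂ ⟶ Y, S.f ≫ g = f) :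
    Nonempty (Ext S.X₃ Y 1 ≃ₗ[k] k) := by
  let ζ' : (S.X₁ ⟶ Y) →ₗ[k] k := { toFun := ζ, map_add' := hadd, map_smul' := hsmul }
  have hζ' : Function.Surjective ζ' := hζ
  have hk : LinearMap.ker (hS.connectingHom k Y) = LinearMap.ker ζ' := by
    ext f
    rw [LinearMap.mem_ker, LinearMap.mem_ker, show ζ' f = ζ f from rfl, hker, hS.connectingHom_eq_zero_iff]
  exact ⟨((hS.connectingHom k Y).quotKerEquivOfSurjective (hS.connectingHom_surjective Y)).symm ≪≫ₗ
    Submodule.quotEquivOfEq _ _ hk ≪≫ₗ ζ'.quotKerEquivOfSurjective hζ'⟩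

end Ext

/-! ### Generation of the enveloping algebra by the Lie algebra -/

namespace UniversalEnvelopingAlgebra

attribute [local instance] LieRing.ofAssociativeRing

variable {R L : Type*} [CommRing R] [LieRing L] [LieAlgebra R L]

/-- The universal property lifts `ι` to a map into `S`; composed with the inclusion it is the
identity, by uniqueness. -/
theorem subalgebra_eq_top (S : Subalgebra R (UniversalEnvelopingAlgebra R L))
    (hS : ∀ x, ι R x ∈ S) : S = ⊤ := by
  let g : L →ₗ⁅R⁆ S :=
    { toFun := fun x => ⟨ι R x, hS x⟩
      map_add' := fun x y => Subtype.ext (map_add _ x y)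
      map_smul' := fun c x => Subtype.ext (map_smul _ c x)
      map_lie' := fun {x y} => Subtype.ext (LieHom.map_lie _ x y) }
  have h : S.val.comp (lift R g) = AlgHom.id R _ := by
    refine hom_ext R ?_
    ext x
    simp [g]
  rw [eq_top_iff]
  intro a _
  have ha : ((lift R g a : S) : UniversalEnvelopingAlgebra R L) = a := DFunLike.congr_fun h a
  exact ha ▸ (lift R g a).2

theorem map_apply_of_map_ι_apply {M N : Type*} [AddCommGroup M] [Module R M]
    [AddCommGroup N] [Module R N] (σ : UniversalEnvelopingAlgebra R L →ₐ[R] Module.End R M)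
    (τ : UniversalEnvelopingAlgebra R L →ₐ[R] Module.End R N)
    (g : M →ₗ[R] N) (hg : ∀ x m, g (σ (ι R x) m) = τ (ι R x) (g m))
    (a : UniversalEnvelopingAlgebra R L) (m : M) : g (σ a m) = τ a (g m) := by
  let S : Subalgebra R (UniversalEnvelopingAlgebra R L) :=
    { carrier := {a | ∀ m, g (σ a m) = τ a (g m)}
      mul_mem' := fun {a b} ha hb m => by
        rw [map_mul, map_mul, Module.End.mul_apply, Module.End.mul_apply, ha, hb]
      add_mem' := fun {a b} ha hb m => by
        rw [map_add, map_add, LinearMap.add_apply, LinearMap.add_apply, map_add, ha, hb]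
      algebraMap_mem' := fun r m => by
        rw [AlgHom.commutes, AlgHom.commutes, Module.algebraMap_end_apply,
          Module.algebraMap_end_apply, map_smul] }
  have : a ∈ S := subalgebra_eq_top S hg ▸ Algebra.mem_top
  exact this m

end UniversalEnvelopingAlgebra

namespace SchrodingerAlgebra

open Module CategoryTheory

attribute [local instance] LieRing.ofAssociativeRing

local notation "𝒰" => UniversalEnvelopingAlgebra ℂ SchrodingerAlgebra
local notation "ι𝒰" => UniversalEnvelopingAlgebra.ι ℂ (L := SchrodingerAlgebra)

universe v

/-! ### Cocycles and the relations of a free presentation -/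

section FreePresentation

variable {V : Type v} [AddCommGroup V] [Module ℂ V] [Module 𝒰 V] {I : Type v} (b : Basis I ℂ V)

/-- The surjection onto `V` from the free `U(𝔰)`-module on a basis of `V`. -/
noncomputable def freeCover : (I →₀ 𝒰) →ₗ[𝒰] V :=
  Finsupp.linearCombination 𝒰 b

/-- The linear section of `freeCover` sending basis vectors to generators. -/
noncomputable def freeSection : V →ₗ[ℂ] (I →₀ 𝒰) :=
  b.constr ℂ fun i => Finsupp.single i 1

variable [IsScalarTower ℂ 𝒰 V]

theorem freeCover_freeSection (v : V) : freeCover b (freeSection b v) = v := by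
  have : (freeCover b).restrictScalars ℂ ∘ₗ freeSection b = LinearMap.id :=
    b.ext fun i => by simp [freeCover, freeSection]
  exact LinearMap.congr_fun this v

theorem freeCover_surjective : Function.Surjective (freeCover b) :=
  fun v => ⟨_, freeCover_freeSection b v⟩

theorem sub_freeSection_mem_ker (y : I →₀ 𝒰) :
    y - freeSection b (freeCover b y) ∈ LinearMap.ker (freeCover b) := by
  rw [LinearMap.mem_ker, map_sub, freeCover_freeSection, sub_self]

variable {b} {ρ : SchrodingerAlgebra →ₗ⁅ℂ⁆ End ℂ V}

/-- The defect of linearity `x s(v) - s(x v)` of the section. -/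
noncomputable def sectionDefect (b : Basis I ℂ V) (x : SchrodingerAlgebra) :
    V →ₗ[ℂ] LinearMap.ker (freeCover b) :=
  LinearMap.codRestrict ((LinearMap.ker (freeCover b)).restrictScalars ℂ)
    (Algebra.lsmul ℂ ℂ (I →₀ 𝒰) (ι𝒰 x) ∘ₗ freeSection b -
      freeSection b ∘ₗ Algebra.lsmul ℂ ℂ V (ι𝒰 x))
    (fun v => by simp [freeCover_freeSection])

theorem coe_sectionDefect (x : SchrodingerAlgebra) (v : V) :
    (sectionDefect b x v : I →₀ 𝒰) = ι𝒰 x • freeSection b v - freeSection b (ι𝒰 x • v) := rfl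

/-- The cocycle attached to a homomorphism on the module of relations. -/
noncomputable def cocycleOfHom (k : LinearMap.ker (freeCover b) →ₗ[𝒰] V) :
    SchrodingerAlgebra →ₗ[ℂ] End ℂ V where
  toFun x := k.restrictScalars ℂ ∘ₗ sectionDefect b x
  map_add' x y := by
    ext v
    simp only [LinearMap.comp_apply, LinearMap.add_apply, ← map_add]
    congr 1
    refine Subtype.ext ?_
    simp only [Submodule.coe_add, coe_sectionDefect, map_add, add_smul]
    abel
  map_smul' c x := by
    ext v
    simp only [LinearMap.comp_apply, LinearMap.smul_apply, ← map_smul, RingHom.id_apply]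
    congr 1
    refine Subtype.ext ?_
    simp only [coe_sectionDefect, map_smul, smul_assoc]
    exact (smul_sub _ _ _).symm

theorem cocycleOfHom_apply (k : LinearMap.ker (freeCover b) →ₗ[𝒰] V) (x : SchrodingerAlgebra)
    (v : V) : cocycleOfHom k x v = k (sectionDefect b x v) := rfl

/-- The defect is the coboundary of the section in the free module, so it satisfies the cocycle
identity, which the linear map `k` transports to `V`. -/
theorem isCocycle_cocycleOfHom (hρ : ∀ x v, ι𝒰 x • v = ρ x v)
    (k : LinearMap.ker (freeCover b) →ₗ[𝒰] V) :
    IsCocycle ρ (cocycleOfHom k) := by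
  intro x y v
  simp only [cocycleOfHom_apply, ← hρ, ← map_smul, ← map_sub]
  congr 1
  refine Subtype.ext ?_
  simp only [Submodule.coe_sub, Submodule.coe_smul, coe_sectionDefect, LieHom.map_lie,
    Ring.lie_def, sub_smul, mul_smul, map_sub, smul_sub]
  abel

/-- With section `s` and cover `π`, the extension is `y ↦ k (y - s (π y)) + T (π y)`; the commutator
identity is what makes it `U(𝔰)`-linear. -/
theorem exists_extension_of_commutator (hρ : ∀ x v, ι𝒰 x • v = ρ x v)
    (k : LinearMap.ker (freeCover b) →ₗ[𝒰] V) {T : End ℂ V}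
    (hT : ∀ x w, cocycleOfHom k x w = ρ x (T w) - T (ρ x w)) :
    ∃ ψ : (I →₀ 𝒰) →ₗ[𝒰] V, ψ ∘ₗ (LinearMap.ker (freeCover b)).subtype = k := by
  let r : (I →₀ 𝒰) →ₗ[ℂ] LinearMap.ker (freeCover b) :=
    LinearMap.codRestrict ((LinearMap.ker (freeCover b)).restrictScalars ℂ)
      (LinearMap.id - freeSection b ∘ₗ (freeCover b).restrictScalars ℂ)
      (sub_freeSection_mem_ker b)
  have hr (y : I →₀ 𝒰) : (r y : I →₀ 𝒰) = y - freeSection b (freeCover b y) := rfl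
  let g : (I →₀ 𝒰) →ₗ[ℂ] V :=
    k.restrictScalars ℂ ∘ₗ r + T ∘ₗ (freeCover b).restrictScalars ℂ
  have hgapp (y : I →₀ 𝒰) : g y = k (r y) + T (freeCover b y) := rfl
  have hg (x : SchrodingerAlgebra) (y : I →₀ 𝒰) : g (ι𝒰 x • y) = ι𝒰 x • g y := by
    have h1 : r (ι𝒰 x • y) = ι𝒰 x • r y + sectionDefect b x (freeCover b y) := by
      refine Subtype.ext ?_
      simp only [Submodule.coe_add, Submodule.coe_smul, coe_sectionDefect, hr, map_smul, smul_sub]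
      abel
    rw [hgapp, hgapp, h1, map_add, map_smul, map_smul, ← cocycleOfHom_apply, hT, smul_add, hρ,
      hρ x (T _), hρ x (freeCover b y)]
    abel
  have hg' : ∀ (a : 𝒰) y, g (a • y) = a • g y :=
    UniversalEnvelopingAlgebra.map_apply_of_map_ι_apply (Algebra.lsmul ℂ ℂ (I →₀ 𝒰))
      (Algebra.lsmul ℂ ℂ V) g hg
  refine ⟨{ g with map_smul' := hg' }, ?_⟩
  ext ⟨y, hy⟩
  change k (r y) + T (freeCover b y) = _
  have h2 : r y = ⟨y, hy⟩ := Subtype.ext (by rw [hr, LinearMap.mem_ker.1 hy]; simp)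
  rw [h2, LinearMap.mem_ker.1 hy, map_zero, add_zero]

/-- The cocycle makes `V × V` a `U(𝔰)`-module. Sending generators to `(b i, 0)` defines a map `F`
from the free module lifting the cover, and `k` is its second coordinate on relations. -/
theorem exists_hom_cocycleOfHom_eq (hρ : ∀ x v, ι𝒰 x • v = ρ x v) (b : Basis I ℂ V)
    {φ : SchrodingerAlgebra →ₗ[ℂ] End ℂ V} (hφ : IsCocycle ρ φ) :
    ∃ k : LinearMap.ker (freeCover b) →ₗ[𝒰] V, cocycleOfHom k = φ := by
  let σ : 𝒰 →ₐ[ℂ] End ℂ (V × V) := UniversalEnvelopingAlgebra.lift ℂ hφ.extension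
  have hσ (x : SchrodingerAlgebra) : σ (ι𝒰 x) = hφ.extension x :=
    UniversalEnvelopingAlgebra.lift_ι_apply _ _ _
  have hinr (a : 𝒰) (u : V) : σ a (0, u) = (0, a • u) :=
    (UniversalEnvelopingAlgebra.map_apply_of_map_ι_apply (Algebra.lsmul ℂ ℂ V) σ
      (LinearMap.inr ℂ V V) (fun x u => by
        rw [hσ, LinearMap.inr_apply, LinearMap.inr_apply, hφ.extension_apply_inr, ← hρ]
        rfl) a u).symm
  have hfst (a : 𝒰) (w : V × V) : (σ a w).1 = a • w.1 :=
    UniversalEnvelopingAlgebra.map_apply_of_map_ι_apply σ (Algebra.lsmul ℂ ℂ V)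
      (LinearMap.fst ℂ V V) (fun x u => by rw [hσ]; exact (hρ x u.1).symm) a w
  let F : (I →₀ 𝒰) →ₗ[ℂ] V × V :=
    Finsupp.lsum ℂ fun i => LinearMap.applyₗ (b i, (0 : V)) ∘ₗ σ.toLinearMap
  have hFsingle (i : I) (c : 𝒰) : F (Finsupp.single i c) = σ c (b i, 0) := by simp [F]
  have hF (a : 𝒰) (y : I →₀ 𝒰) : F (a • y) = σ a (F y) := by
    induction y using Finsupp.induction_linear with
    | zero => simp
    | add y y' hy hy' => rw [smul_add, map_add, hy, hy', map_add, map_add]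
    | single i c =>
      rw [Finsupp.smul_single, hFsingle, hFsingle, smul_eq_mul, map_mul, End.mul_apply]
  have hFs (v : V) : F (freeSection b v) = (v, 0) := by
    have : F ∘ₗ freeSection b = LinearMap.inl ℂ V V := b.ext fun i => by simp [F, freeSection]
    exact LinearMap.congr_fun this v
  have hFfst (y : I →₀ 𝒰) : (F y).1 = freeCover b y := by
    induction y using Finsupp.induction_linear with
    | zero => simp
    | add y y' hy hy' => rw [map_add, map_add, Prod.fst_add, hy, hy']
    | single i c => rw [hFsingle, hfst, freeCover, Finsupp.linearCombination_single]
  let k : LinearMap.ker (freeCover b) →ₗ[𝒰] V :=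
    { toFun := fun y => (F y).2
      map_add' := fun y y' => by simp
      map_smul' := fun a y => by
        have : F y = (0, (F y).2) := Prod.ext ((hFfst y).trans y.2) rfl
        rw [Submodule.coe_smul, hF, this, hinr, RingHom.id_apply] }
  refine ⟨k, ?_⟩
  ext x v
  change (F (ι𝒰 x • freeSection b v - freeSection b (ι𝒰 x • v))).2 = _
  rw [map_sub, hF, hFs, hFs, hσ, IsCocycle.extension_apply]
  simp

end FreePresentation

/-! ### A cocycle with nonzero value at `z`, and the computation of `Ext¹` -/

section Scaling

/-- The derivation of the Schrödinger algebra that vanishes on `sl₂`, halves `p` and `q`, and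
fixes `z`. -/
noncomputable def scalingDerivation : SchrodingerAlgebra →ₗ[ℂ] SchrodingerAlgebra where
  toFun x := (x 3 / 2) • p + (x 4 / 2) • q + x 5 • z
  map_add' x y := by simp only [add_apply]; module
  map_smul' c x := by simp only [smul_apply, RingHom.id_apply]; module

theorem scalingDerivation_lie (x y : SchrodingerAlgebra) :
    scalingDerivation ⁅x, y⁆ = ⁅x, scalingDerivation y⁆ - ⁅y, scalingDerivation x⁆ := by
  ext i
  fin_cases i <;>
    simp [scalingDerivation, p, q, z, basis_apply, sub_eq_add_neg] <;> ring

theorem scalingDerivation_z : scalingDerivation z = z := by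
  simp [scalingDerivation, z, basis_apply]

theorem isCocycle_scalingDerivation {E : Type*} [AddCommGroup E] [Module ℂ E]
    (ρ : SchrodingerAlgebra →ₗ⁅ℂ⁆ End ℂ E) :
    IsCocycle ρ ((ρ : SchrodingerAlgebra →ₗ[ℂ] End ℂ E) ∘ₗ scalingDerivation) := by
  intro x y w
  simp [scalingDerivation_lie, Ring.lie_def]

end Scaling

theorem nonempty_ext_linearEquiv {V : Type v} [AddCommGroup V] [Module ℂ V] [Module 𝒰 V]
    [IsScalarTower ℂ 𝒰 V] {ρ : SchrodingerAlgebra →ₗ⁅ℂ⁆ End ℂ V}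
    (hρ : ∀ x v, ι𝒰 x • v = ρ x v) (hirr : HasNoProperInvariant ρ)
    (hinf : ¬ FiniteDimensional ℂ V) (hs : Submodule.span ℂ (stringVectors ρ) = ⊤) :
    Nonempty (Abelian.Ext (ModuleCat.of 𝒰 V) (ModuleCat.of 𝒰 V) 1 ≃ₗ[ℂ] ℂ) := by
  have : Nontrivial V := by
    by_contra hc
    have := not_nontrivial_iff_subsingleton.1 hc
    exact hinf inferInstance
  obtain ⟨n, ⟨v, hv, hv0⟩, hn⟩ := exists_lowest_highestWeight hs
  obtain ⟨⟨c, hc0, hc⟩, hle⟩ := exists_central_character hirr hinf hs hn hv hv0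
  let b := Basis.ofVectorSpace ℂ V
  have hexact := LinearMap.shortExact_shortComplexKer (freeCover_surjective b)
  obtain ⟨ℓ, hℓ⟩ : ∃ ℓ : Dual ℂ V, ℓ v ≠ 0 := by
    by_contra! hc
    exact hv0 ((forall_dual_apply_eq_zero_iff ℂ v).1 hc)
  -- As `[x, z] = 0` and `ρ z` is scalar, the cocycle identity says that `φ z` commutes with the
  -- action.
  have hscal (k : LinearMap.ker (freeCover b) →ₗ[𝒰] V) : ∃ a : ℂ, cocycleOfHom k z = a • 1 := by
    refine exists_eq_smul_one_of_commute hirr hv hv0 hle fun x w => ?_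
    have := isCocycle_cocycleOfHom hρ k x z w
    rw [lie_z, map_zero, LinearMap.zero_apply, hc] at this
    simp only [LinearMap.smul_apply, End.one_apply, map_smul, sub_self, sub_zero] at this
    exact (sub_eq_zero.1 this.symm).symm
  -- Evaluating through `ℓ` and `v` reads off the scalar `φ z` up to the nonzero factor `ℓ v`.
  refine hexact.nonempty_ext_linearEquiv (ModuleCat.of 𝒰 V)
    (fun k => ℓ (cocycleOfHom k.hom z v)) (fun k k' => by rw [← map_add]; rfl) (fun a k => ?_) ?_ ?_
  · rw [← smul_eq_mul, ← map_smul]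
    congr 1
    exact algebraMap_smul 𝒰 a (cocycleOfHom k.hom z v)
  · obtain ⟨k, hk⟩ := exists_hom_cocycleOfHom_eq hρ b (isCocycle_scalingDerivation ρ)
    have hne : ℓ (cocycleOfHom k z v) ≠ 0 := by
      rw [hk]
      simp [scalingDerivation_z, hc, hc0, hℓ]
    intro a
    refine ⟨ModuleCat.ofHom ((a / ℓ (cocycleOfHom k z v)) • k), ?_⟩
    change ℓ ((a / ℓ (cocycleOfHom k z v)) • cocycleOfHom k z v) = a
    rw [map_smul, smul_eq_mul, div_mul_cancel₀ _ hne]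
  · intro k
    constructor
    · intro hk
      obtain ⟨a, ha⟩ := hscal k.hom
      have hk : ℓ (cocycleOfHom k.hom z v) = 0 := hk
      have hz : cocycleOfHom k.hom z = 0 := by
        rw [ha, LinearMap.smul_apply, End.one_apply, map_smul, smul_eq_mul, mul_eq_zero] at hk
        rw [ha, hk.resolve_right hℓ, zero_smul]
      obtain ⟨T, hT⟩ := (isCocycle_cocycleOfHom hρ k.hom).exists_eq_commutator hirr hs hn hv hv0
        hc hz
      obtain ⟨ψ, hψ⟩ := exists_extension_of_commutator hρ k.hom hT
      exact ⟨ModuleCat.ofHom ψ, ModuleCat.hom_ext hψ⟩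
    · rintro ⟨g, rfl⟩
      -- For a restricted `g` the value is `z g(s v) - g(s(z v))`, and `z` acts by `c` in both
      -- terms.
      change ℓ (g.hom (sectionDefect b z v : Basis.ofVectorSpaceIndex ℂ V →₀ 𝒰)) = 0
      rw [coe_sectionDefect, map_sub, map_smul, hρ, hρ, hc]
      simp

end SchrodingerAlgebra

theorem theorem5p16 {V : Type*} [AddCommGroup V] [Module ℂ V]
    [LieRingModule SchrodingerAlgebra V] [LieModule ℂ SchrodingerAlgebra V]
    (hsimple : LieModule.IsIrreducible ℂ SchrodingerAlgebra V)
    (hHC : IsHarishChandraModule SchrodingerAlgebra.sl2 V)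
    (hinf : ¬ FiniteDimensional ℂ V) :
    Nonempty (CategoryTheory.Abelian.Ext (envelopingModule SchrodingerAlgebra V)
      (envelopingModule SchrodingerAlgebra V) 1 ≃ₗ[ℂ] ℂ) := by
  let _ : Module (UniversalEnvelopingAlgebra ℂ SchrodingerAlgebra) V :=
    Module.compHom V (UniversalEnvelopingAlgebra.lift ℂ
      (LieModule.toEnd ℂ SchrodingerAlgebra V)).toRingHom
  have : IsScalarTower ℂ (UniversalEnvelopingAlgebra ℂ SchrodingerAlgebra) V :=
    IsScalarTower.of_algebraMap_smul fun c v => envelopingModule_algebraMap_smul c v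
  refine SchrodingerAlgebra.nonempty_ext_linearEquiv
    (ρ := LieModule.toEnd ℂ SchrodingerAlgebra V) (fun x v => envelopingModule_ι_smul x v)
    (fun S hS => ?_) hinf (SchrodingerAlgebra.span_stringVectors_eq_top hHC)
  let N : LieSubmodule ℂ SchrodingerAlgebra V := { S with lie_mem := fun {x w} hw => hS x w hw }
  rcases eq_bot_or_eq_top N with h | h
  · exact Or.inl (congrArg LieSubmodule.toSubmodule h)
  · exact Or.inr (congrArg LieSubmodule.toSubmodule h)
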